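/- Let $N,M$ be positive integers, let $H$ be a vector space of dimension $N+M$ over a finite field $\mathbb F_q$ with $q$ elements, and let $h\subseteq H$ be a subspace of dimension $M$. Let $X$ be the set of subspaces $y\subseteq H$ with $y\cap h=0$, partially ordered by inclusion; $z$ covers $y$ if $y<z$ and no $w\in X$ satisfies $y<w<z$. Define the following matrices in $\mathrm{Mat}_X(\mathbb C)$, acting on $V=\mathbb C^X$: $R_{y,z}=1$ if $y$ covers $z$ and $0$ otherwise; $L'=R^t$; $A^*$ is diagonal with $(A^*)_{y,y}=q^{-\dim y}$; $E^*_i$ $(0\le i\le N)$ is diagonal with $(E^*_i)_{y,y}=1$ if $\dim y=i$ and $0$ otherwise; and $A_{y,z}=1$ if $y$ covers $z$, $A_{y,z}=q^{\dim y}$ if $z$ covers $y$, $A_{y,z}=0$ otherwise. For $x\in\{0,\tfrac12,1,\dots,N\}$ let $\theta_x=\frac{q^{N-x}-q^x}{q-1}q^{M/2}$, and let $E_x$ be the primitive idempotent of the diagonalizable matrix $A$ for the eigenvalue $\theta_x$ (the projection of $V$ onto the $\theta_x$-eigenspace of $A$ along the sum of the other eigenspaces). Let $T$ be the subalgebra of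 $\mathrm{Mat}_X(\mathbb C)$ generated by $R,L',A^*$. A $T$-module is a $T$-invariant subspace of $V$; it is irreducible if it is nonzero and contains no $T$-modules other than $0$ and itself. For an irreducible $T$-module $W$, its endpoint is $r=\min\{i: 0\le i\le N,\ E^*_iW\ne0\}$ and its diameter is $d=|\{i: 0\le i\le N,\ E^*_iW\neq 0\}|-1$. A Leonard pair on a vector space $W$ of finite positive dimension is an ordered pair of linear maps $B,B^*:W\to W$ such that in some basis $B$ is diagonal and $B^*$ is irreducible tridiagonal, and in some basis $B^*$ is diagonal and $B$ is irreducible tridiagonal. A Leonard system on $W$ of diameter $d$ is a sequence $\Phi=(B;\{F_i\}_{i=0}^d;B^*;\{F^*_i\}_{i=0}^d)$ of linear maps on $W$ such that $B$ and $B^*$ are multiplicity-free (diagonalizable with all eigenspaces of dimension one), $\{F_i\}$ and $\{F^*_i\}$ are orderings of the primitive idempotents of $B$ and of $B^*$, and $F_iB^*F_j$ and $F^*_iBF^*_j$ are zero if $|i-j|>1$ and nonzero if $|i-j|=1$. Its eigenvalue sequence $\{\vartheta_i\}$ (dual eigenvalue sequence $\{\vartheta^*_i\}$) lists the eigenvalues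 of $B$ (of $B^*$) belonging to the $F_i$ (to the $F^*_i$). $\Phi$ is bipartite if $\mathrm{tr}(F^*_iB)=0$ for $0\le i\le d$. The first split sequence of $\Phi$ is the unique sequence $\{\varphi_i\}_{i=1}^d$ for which some basis of $W$ makes $B$ lower bidiagonal with diagonal $\vartheta_0,\dots,\vartheta_d$ and subdiagonal entries $1$, and $B^*$ upper bidiagonal with diagonal $\vartheta^*_0,\dots,\vartheta^*_d$ and superdiagonal $\varphi_1,\dots,\varphi_d$; the second split sequence $\{\phi_i\}_{i=1}^d$ is the first split sequence of $(B;\{F_{d-i}\};B^*;\{F^*_i\})$. $\Phi$ is of dual $q$-Krawtchouk type with parameters $(d,h,h^*,s,\vartheta_0,\vartheta_0^*)$ if $h,h^*,s$ are nonzero, $q^i\ne1$ for $1\le i\le d$, $sq^i\neq1$ for $2\le i\le 2d$, and $$\vartheta_i=\vartheta_0+h(1-q^i)(1-sq^{i+1})q^{-i},\qquad \vartheta^*_i=\vartheta^*_0+h^*(1-q^i)q^{-i}\qquad(0\le i\le d),$$ $$\varphi_i=hh^*q^{1-2i}(1-q^i)(1-q^{i-d-1}),\qquad \phi_i=hh^*s\,q^{d+2-2i}(1-q^i)(1-q^{i-d-1})\qquad(1\le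 i\le d).$$ **Theorem.** Let $W$ be an irreducible $T$-module with endpoint $r$ and diameter $d$, and let $t=(N-d)/2$. Then $A,A^*$ act on $W$ as a Leonard pair; $W$ is invariant under all $E_{t+i}$ and $E^*_{r+i}$ $(0\le i\le d)$, and $(A;\{E_{t+i}\}_{i=0}^d;A^*;\{E^*_{r+i}\}_{i=0}^d)$ acts on $W$ as a Leonard system $\Phi$. This $\Phi$ is bipartite, its eigenvalue sequence and dual eigenvalue sequence are $$\vartheta_i=\frac{q^{d-i}-q^i}{q-1}\,q^{M/2+t},\qquad \vartheta^*_i=q^{-r-i}\qquad(0\le i\le d),$$ and $\Phi$ is of dual $q$-Krawtchouk type with parameters $$d(\Phi)=d,\quad h=\frac{q^{d+t+M/2}}{q-1},\quad h^*=q^{-r},\quad s=-q^{-d-1},\quad \vartheta_0=\frac{q^d-1}{q-1}q^{M/2+t},\quad \vartheta^*_0=q^{-r}.$$ -/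

import Mathlib

noncomputable section

/-! ### Leonard pairs and Leonard systems -/

section Leonard

variable {K W : Type*} [Field K] [AddCommGroup W] [Module K W]

/-- A square matrix is irreducible tridiagonal: its entries vanish off the three central diagonals,
and all entries on the superdiagonal and on the subdiagonal are nonzero. -/
def IsIrreducibleTridiagonal {n : ℕ} (B : Matrix (Fin n) (Fin n) K) : Prop :=
  ∀ i j : Fin n,
    (((i : ℕ) + 1 < j ∨ (j : ℕ) + 1 < i) → B i j = 0) ∧
    (((i : ℕ) + 1 = j ∨ (j : ℕ) + 1 = i) → B i j ≠ 0)

/-- The ordered pair `A, As` is a Leonard pair on the vector space `W` (of finite positive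
dimension): in some basis `A` is diagonal and `As` irreducible tridiagonal, and in some basis
`As` is diagonal and `A` irreducible tridiagonal. -/
def IsLeonardPair (A As : Module.End K W) : Prop :=
  0 < Module.finrank K W ∧
  (∃ b : Module.Basis (Fin (Module.finrank K W)) K W,
    (LinearMap.toMatrix b b A).IsDiag ∧ IsIrreducibleTridiagonal (LinearMap.toMatrix b b As)) ∧
  (∃ b : Module.Basis (Fin (Module.finrank K W)) K W,
    (LinearMap.toMatrix b b As).IsDiag ∧ IsIrreducibleTridiagonal (LinearMap.toMatrix b b A))

/-- Diagonalizable, with every eigenspace of dimension one. -/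
def IsMultiplicityFree (A : Module.End K W) : Prop :=
  (⨆ μ : K, A.eigenspace μ) = ⊤ ∧
  ∀ μ : K, A.HasEigenvalue μ → Module.finrank K (A.eigenspace μ) = 1

open Classical in
/-- The primitive idempotent of a diagonalizable map `A` for the eigenvalue `μ`: the projection onto
the `μ`-eigenspace that vanishes on all the other eigenspaces.  (It is set to `0` when the
eigenspaces do not give a decomposition of the whole space.) -/
def primitiveIdempotent (A : Module.End K W) (μ : K) : Module.End K W :=
  if hc : IsCompl (A.eigenspace μ) (⨆ ν : K, ⨆ _ : ν ≠ μ, A.eigenspace ν) then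
    Submodule.projection _ _ hc
  else 0

/-- `θ_0, …, θ_d` is an ordering (without repetition) of the eigenvalues of `A`, and `E_i` is the
primitive idempotent of `A` for `θ_i`. -/
def IsEigenvalueSequence {d : ℕ} (A : Module.End K W) (E : Fin (d + 1) → Module.End K W)
    (θ : Fin (d + 1) → K) : Prop :=
  Function.Injective θ ∧ Set.range θ = {μ : K | A.HasEigenvalue μ} ∧
  ∀ i, E i = primitiveIdempotent A (θ i)

/-- `E_i B E_j` vanishes for `|i - j| > 1` and does not vanish for `|i - j| = 1`. -/
def ActsIrreduciblyTridiagonally {d : ℕ} (E : Fin (d + 1) → Module.End K W)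
    (B : Module.End K W) : Prop :=
  ∀ i j : Fin (d + 1),
    (((i : ℕ) + 1 < j ∨ (j : ℕ) + 1 < i) → E i * B * E j = 0) ∧
    (((i : ℕ) + 1 = j ∨ (j : ℕ) + 1 = i) → E i * B * E j ≠ 0)

variable (K W) in
/-- A Leonard system `(A; {E_i}; A*; {E*_i})` of diameter `d` on `W`: both `A` and `A*` are
multiplicity-free, `E` and `E*` are orderings of their primitive idempotents, and each of `A`, `A*`
acts in an irreducible tridiagonal fashion on the eigenspaces of the other. -/
structure LeonardSystem (d : ℕ) where
  A : Module.End K W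
  E : Fin (d + 1) → Module.End K W
  As : Module.End K W
  Es : Fin (d + 1) → Module.End K W
  multiplicityFree : IsMultiplicityFree A
  multiplicityFree_dual : IsMultiplicityFree As
  ordering : ∃ θ : Fin (d + 1) → K, IsEigenvalueSequence A E θ
  ordering_dual : ∃ θs : Fin (d + 1) → K, IsEigenvalueSequence As Es θs
  tridiagonal : ActsIrreduciblyTridiagonally E As
  tridiagonal_dual : ActsIrreduciblyTridiagonally Es A

/-- There is a basis in which `A` is lower bidiagonal with diagonal `θ_0, …, θ_d` and all entries `1`
on the subdiagonal, and in which `As` is upper bidiagonal with diagonal `θs_0, …, θs_d` and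
superdiagonal `φ_1, …, φ_d`. -/
def IsSplitSequence {d : ℕ} (A As : Module.End K W) (θ θs : Fin (d + 1) → K) (φ : ℕ → K) : Prop :=
  ∃ b : Module.Basis (Fin (d + 1)) K W, ∀ i j : Fin (d + 1),
    LinearMap.toMatrix b b A i j =
      (if i = j then θ i else if (i : ℕ) = j + 1 then 1 else 0) ∧
    LinearMap.toMatrix b b As i j =
      (if i = j then θs i else if (j : ℕ) = i + 1 then φ j else 0)

namespace LeonardSystem

variable {d : ℕ} (Φ : LeonardSystem K W d)

/-- `a_i = tr (E*_i A)` vanishes for all `i`. -/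
def IsBipartite : Prop := ∀ i, LinearMap.trace K W (Φ.Es i * Φ.A) = 0

/-- The parameter array of a Leonard system: eigenvalue sequence `θ_0, …, θ_d`, dual eigenvalue
sequence `θs_0, …, θs_d`, first split sequence `φ_1, …, φ_d`, and second split sequence
`ψ_1, …, ψ_d` (the first split sequence for the reversed ordering of the `E_i`).
The values of `φ`, `ψ` outside `1, …, d` play no role. -/
structure IsParameterArray (θ θs : Fin (d + 1) → K) (φ ψ : ℕ → K) : Prop where
  eigenvalue : IsEigenvalueSequence Φ.A Φ.E θ
  dualEigenvalue : IsEigenvalueSequence Φ.As Φ.Es θs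
  firstSplit : IsSplitSequence Φ.A Φ.As θ θs φ
  secondSplit : IsSplitSequence Φ.A Φ.As (fun i => θ i.rev) θs ψ

/-- A Leonard system of dual `q`-Krawtchouk type, with parameters `h, hs, s, θ0, θs0`. -/
structure IsDualQKrawtchouk (q h hs s θ0 θs0 : K) : Prop where
  q_ne_zero : q ≠ 0
  h_ne_zero : h ≠ 0
  hs_ne_zero : hs ≠ 0
  s_ne_zero : s ≠ 0
  q_pow_ne_one : ∀ i : ℕ, 1 ≤ i → i ≤ d → q ^ i ≠ 1
  s_mul_q_pow_ne_one : ∀ i : ℕ, 2 ≤ i → i ≤ 2 * d → s * q ^ i ≠ 1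
  parameterArray : Φ.IsParameterArray
    (fun i => θ0 + h * (1 - q ^ (i : ℕ)) * (1 - s * q ^ ((i : ℕ) + 1)) / q ^ (i : ℕ))
    (fun i => θs0 + hs * (1 - q ^ (i : ℕ)) / q ^ (i : ℕ))
    (fun i => h * hs * q ^ (1 - 2 * (i : ℤ)) * (1 - q ^ i) * (1 - q ^ ((i : ℤ) - d - 1)))
    (fun i => h * hs * s * q ^ ((d : ℤ) + 2 - 2 * i) * (1 - q ^ i) *
      (1 - q ^ ((i : ℤ) - d - 1)))

end LeonardSystem

end Leonard

/-! ### The Attenuated Space poset -/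

namespace AttenuatedSpace

variable {F H : Type*} [Field F] [AddCommGroup H] [Module F H]

/-- The subspaces of `H` that have zero intersection with `h`. -/
def Vertex (h : Submodule F H) : Type _ := {y : Submodule F H // y ⊓ h = ⊥}

/-- The inclusion order. -/
instance (h : Submodule F H) : PartialOrder (Vertex h) :=
  inferInstanceAs (PartialOrder {y : Submodule F H // y ⊓ h = ⊥})

instance (h : Submodule F H) [Finite F] [FiniteDimensional F H] : Finite (Vertex h) :=
  haveI : Finite H := Module.finite_of_finite F
  inferInstanceAs (Finite {y : Submodule F H // y ⊓ h = ⊥})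

instance (h : Submodule F H) [Finite F] [FiniteDimensional F H] : Fintype (Vertex h) :=
  Fintype.ofFinite _

instance (h : Submodule F H) : DecidableEq (Vertex h) := Classical.decEq _

/-- The rank of a vertex. -/
def Vertex.dim {h : Submodule F H} (y : Vertex h) : ℕ := Module.finrank F y.1

variable (h : Submodule F H)

open Classical in
/-- The raising matrix `R`: the `(y,z)`-entry is `1` if `y` covers `z`, and `0` otherwise. -/
def raising : Matrix (Vertex h) (Vertex h) ℂ :=
  Matrix.of fun y z => if z ⋖ y then 1 else 0

open Classical in
/-- The lowering matrix `L'`: the `(y,z)`-entry is `1` if `z` covers `y`, and `0` otherwise. -/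
def lowering : Matrix (Vertex h) (Vertex h) ℂ :=
  Matrix.of fun y z => if y ⋖ z then 1 else 0

/-- The diagonal matrix `A*` with `(y,y)`-entry `q ^ (- dim y)`, where `q = |F|`. -/
def dualAdj : Matrix (Vertex h) (Vertex h) ℂ :=
  Matrix.diagonal fun y => ((Nat.card F : ℂ) ^ y.dim)⁻¹

/-- The diagonal matrix `E*_i` with `(y,y)`-entry `1` if `dim y = i`, and `0` otherwise. -/
def dualIdem (i : ℕ) : Matrix (Vertex h) (Vertex h) ℂ :=
  Matrix.diagonal fun y => if y.dim = i then 1 else 0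

open Classical in
/-- The `q`-adjacency matrix `A`: the `(y,z)`-entry is `1` if `y` covers `z`, `q ^ dim y` if `z`
covers `y`, and `0` if `y, z` are not adjacent. -/
def qAdj : Matrix (Vertex h) (Vertex h) ℂ :=
  Matrix.of fun y z => if z ⋖ y then 1 else if y ⋖ z then (Nat.card F : ℂ) ^ y.dim else 0

/-- `θ_x = (q^(N-x) - q^x) q^(M/2) / (q - 1)`, for a half-integer `x` with `0 ≤ x ≤ N`. -/
def theta (q N M : ℕ) (x : ℝ) : ℝ :=
  ((q : ℝ) ^ ((N : ℝ) - x) - (q : ℝ) ^ x) / ((q : ℝ) - 1) * (q : ℝ) ^ ((M : ℝ) / 2)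

variable [Finite F] [FiniteDimensional F H]

/-- The primitive idempotent `E_x` of `A` for the eigenvalue `θ_x`. -/
def idem (N M : ℕ) (x : ℝ) : Matrix (Vertex h) (Vertex h) ℂ :=
  LinearMap.toMatrix'
    (primitiveIdempotent (Matrix.toLin' (qAdj h)) (theta (Nat.card F) N M x : ℂ))

/-- The subconstituent algebra `T`, generated by `R, L', A*`. -/
def subconstituentAlgebra : Subalgebra ℂ (Matrix (Vertex h) (Vertex h) ℂ) :=
  Algebra.adjoin ℂ {raising h, lowering h, dualAdj h}

variable {h}

open Matrix in
/-- A `T`-module: a subspace of the standard module that is invariant under `T`. -/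
def IsTModule (W : Submodule ℂ (Vertex h → ℂ)) : Prop :=
  ∀ B ∈ subconstituentAlgebra h, ∀ w ∈ W, B *ᵥ w ∈ W

/-- An irreducible `T`-module. -/
def IsIrreducibleTModule (W : Submodule ℂ (Vertex h → ℂ)) : Prop :=
  IsTModule W ∧ W ≠ ⊥ ∧
  ∀ U : Submodule ℂ (Vertex h → ℂ), IsTModule U → U ≤ W → U = ⊥ ∨ U = W

/-- The set of `i` with `0 ≤ i ≤ N` and `E*_i W ≠ 0`. -/
def support (N : ℕ) (W : Submodule ℂ (Vertex h → ℂ)) : Set ℕ :=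
  {i | i ≤ N ∧ W.map (Matrix.toLin' (dualIdem h i)) ≠ ⊥}

/-- The endpoint `min {i | E*_i W ≠ 0}`. -/
def endpoint (N : ℕ) (W : Submodule ℂ (Vertex h → ℂ)) : ℕ := sInf (support N W)

/-- The diameter `|{i | E*_i W ≠ 0}| - 1`. -/
def diameter (N : ℕ) (W : Submodule ℂ (Vertex h → ℂ)) : ℕ := (support N W).ncard - 1

end AttenuatedSpace

end

noncomputable section
-- Counting subspaces over a finite field.
section SubspaceCounting

variable {F V : Type*} [Field F] [AddCommGroup V] [Module F V]

/-! Write `n = N + M`, and let `C = outsideCount h` count the common covers of two vertices that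
meet `h` nontrivially. Allowing these extra covers restores the modularity of the full subspace
lattice: two distinct subspaces have a common cover exactly when they cover a common subspace. Hence
`LR + C - RL` is scalar on each level (`lowering_mul_raising_add_outsideCount`). A count of flags
gives the second relation, `CR = q RC` (`outsideCount_mul_raising`).

In an irreducible module `W` the first relation shows that `C` preserves the bottom level, so it has
an eigenvector `f` there. Both relations make `L` send `R^(k+1) f` to a multiple of `R^k f`. The
span of these vectors is therefore a `T`-module, hence all of `W`. The place where the chain stops
determines the eigenvalue of `C`, so that `r` and `d` fix all coefficients
(`IsIrreducibleTModule.exists_chain`). On the chain, `A` is a weighted walk whose weights involve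
only `κ^2 = q^(n-d)`, and `A*` is diagonal with geometric eigenvalues: this is an `IsLadder`.

The rest is linear algebra on a ladder. Put `u_0 = v_0` and `u_(i+1) = (A - θ_i) u_i`. Then `A` is
lower bidiagonal by construction, and an Askey-Wilson relation shows by induction that `A*` is upper
bidiagonal (`IsLadder.dual_splitVector`). Replacing `κ` by `-κ` leaves the ladder unchanged and
reverses the `θ_i`, so the second split form comes for free. Two split forms with nonzero split
sequences force `A*` to be irreducible tridiagonal on an eigenbasis of `A`
(`isIrreducibleTridiagonal_of_isSplitSequence`). Finally, `A` is diagonalizable on all of `V`, so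
its primitive idempotents restrict to those on `W`. -/

lemma card_projectivization_eq [Finite F] {n : ℕ} (hn : Module.finrank F V = n) :
    (Nat.card (Projectivization F V) : ℂ) = ((Nat.card F : ℂ) ^ n - 1) / ((Nat.card F : ℂ) - 1) := by
  have hq : (Nat.card F : ℂ) ≠ 1 := by
    have : 1 < Nat.card F := Finite.one_lt_card
    exact_mod_cast this.ne'
  rw [Projectivization.card_of_finrank F V hn]
  push_cast
  rw [geom_sum_eq hq]

lemma card_finrank_eq_one [Finite F] {n : ℕ} (hn : Module.finrank F V = n) :
    (Nat.card {L : Submodule F V // Module.finrank F L = 1} : ℂ) =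
      ((Nat.card F : ℂ) ^ n - 1) / ((Nat.card F : ℂ) - 1) := by
  rw [← card_projectivization_eq hn, Nat.card_congr (Projectivization.equivSubmodule F V)]

variable [FiniteDimensional F V]

lemma Submodule.covBy_iff_le_and_finrank {y z : Submodule F V} :
    y ⋖ z ↔ y ≤ z ∧ Module.finrank F z = Module.finrank F y + 1 := by
  constructor
  · intro hyz
    refine ⟨hyz.le, ?_⟩
    obtain ⟨x, hxz, hxy⟩ := SetLike.exists_of_lt hyz.lt
    have hcov := Submodule.covBy_span_singleton_sup (K := F) hxy
    have hle : Submodule.span F {x} ⊔ y ≤ z :=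
      sup_le ((Submodule.span_singleton_le_iff_mem _ _).2 hxz) hyz.le
    have heq : Submodule.span F {x} ⊔ y = z :=
      hle.eq_or_lt.resolve_right fun hlt => hyz.2 hcov.lt hlt
    have hx : x ≠ 0 := fun h0 => hxy (h0 ▸ y.zero_mem)
    have hdisj : Submodule.span F {x} ⊓ y = ⊥ := by
      rw [← disjoint_iff, disjoint_comm, Submodule.disjoint_span_singleton' hx]
      exact hxy
    have hsum := Submodule.finrank_sup_add_finrank_inf_eq (Submodule.span F {x}) y
    rw [heq, hdisj, finrank_bot, finrank_span_singleton hx] at hsum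
    omega
  · rintro ⟨hle, hfin⟩
    refine ⟨lt_of_le_of_ne hle fun he => by subst he; omega, fun w h1 h2 => ?_⟩
    have := Submodule.finrank_lt_finrank_of_lt h1
    have := Submodule.finrank_lt_finrank_of_lt h2
    omega

lemma finrank_comap_mkQ (z : Submodule F V) (L : Submodule F (V ⧸ z)) :
    Module.finrank F (L.comap z.mkQ) = Module.finrank F z + Module.finrank F L := by
  have h1 := Submodule.finrank_quotient_add_finrank ((z.comap (L.comap z.mkQ).subtype))
  have hz : z ≤ L.comap z.mkQ := fun x hx => by
    simp [(Submodule.Quotient.mk_eq_zero z).2 hx]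
  have h2 : Module.finrank F (z.comap (L.comap z.mkQ).subtype) = Module.finrank F z :=
    (Submodule.comapSubtypeEquivOfLe hz).finrank_eq
  have h3 := LinearMap.finrank_range_add_finrank_ker
    (z.mkQ.domRestrict (L.comap z.mkQ))
  have h4 : LinearMap.range (z.mkQ.domRestrict (L.comap z.mkQ)) = L := by
    rw [LinearMap.range_domRestrict, Submodule.map_comap_eq_of_surjective z.mkQ_surjective]
  have h5 : LinearMap.ker (z.mkQ.domRestrict (L.comap z.mkQ)) =
      z.comap (L.comap z.mkQ).subtype := by
    ext x; simp [LinearMap.domRestrict_apply]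
  rw [h4, h5, h2] at h3
  omega

variable [Finite F]

/-- The number of subspaces that cover a given subspace. -/
lemma card_covBy_left (z : Submodule F V) :
    (Nat.card {y : Submodule F V // z ⋖ y} : ℂ) =
      ((Nat.card F : ℂ) ^ (Module.finrank F V - Module.finrank F z) - 1) /
        ((Nat.card F : ℂ) - 1) := by
  -- Covers of `z` correspond to lines of the quotient by `z`.
  rw [← card_finrank_eq_one (V := V ⧸ z) (Submodule.finrank_quotient z)]
  congr 1
  refine Nat.card_congr ⟨fun y => ⟨y.1.map z.mkQ, ?_⟩, fun L => ⟨L.1.comap z.mkQ, ?_⟩, ?_, ?_⟩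
  · obtain ⟨y, hy⟩ := y
    rw [Submodule.covBy_iff_le_and_finrank] at hy
    have h1 := finrank_comap_mkQ z (y.map z.mkQ)
    rw [Submodule.comap_map_mkQ, sup_eq_right.2 hy.1] at h1
    dsimp only
    omega
  · rw [Submodule.covBy_iff_le_and_finrank, finrank_comap_mkQ, L.2]
    exact ⟨Submodule.le_comap_mkQ z L.1, rfl⟩
  · rintro ⟨y, hy⟩
    simp [Submodule.comap_map_mkQ, hy.le]
  · rintro ⟨L, hL⟩
    simp [Submodule.map_comap_eq_of_surjective z.mkQ_surjective]

/-- The number of subspaces of `w` that cover a given subspace `z` of `w`. -/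
lemma card_covBy_left_le {z w : Submodule F V} (hzw : z ≤ w) :
    (Nat.card {y : Submodule F V // z ⋖ y ∧ y ≤ w} : ℂ) =
      ((Nat.card F : ℂ) ^ (Module.finrank F w - Module.finrank F z) - 1) /
        ((Nat.card F : ℂ) - 1) := by
  have hz : Module.finrank F (z.comap w.subtype) = Module.finrank F z :=
    (Submodule.comapSubtypeEquivOfLe hzw).finrank_eq
  rw [← hz, ← card_covBy_left (z.comap w.subtype)]
  congr 1
  refine Nat.card_congr ⟨fun y => ⟨y.1.comap w.subtype, ?_⟩, fun y => ⟨y.1.map w.subtype, ?_⟩,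
    ?_, ?_⟩
  · obtain ⟨y, hy, hyw⟩ := y
    rw [Submodule.covBy_iff_le_and_finrank] at hy ⊢
    rw [hz, (Submodule.comapSubtypeEquivOfLe hyw).finrank_eq]
    exact ⟨Submodule.comap_mono hy.1, hy.2⟩
  · obtain ⟨y, hy⟩ := y
    refine ⟨?_, Submodule.map_subtype_le w y⟩
    rw [Submodule.covBy_iff_le_and_finrank] at hy ⊢
    rw [hz] at hy
    refine ⟨?_, by rw [Submodule.finrank_map_subtype_eq]; exact hy.2⟩
    have := Submodule.map_mono (f := w.subtype) hy.1
    rwa [Submodule.map_comap_subtype, inf_eq_right.2 hzw] at this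
  · rintro ⟨y, hy, hyw⟩
    simp [Submodule.map_comap_subtype, hyw]
  · rintro ⟨y, hy⟩
    simp [Submodule.comap_map_eq_of_injective w.subtype_injective]

/-- The number of hyperplanes of a given subspace. -/
lemma card_covBy_right (y : Submodule F V) :
    (Nat.card {z : Submodule F V // z ⋖ y} : ℂ) =
      ((Nat.card F : ℂ) ^ Module.finrank F y - 1) / ((Nat.card F : ℂ) - 1) := by
  -- Taking annihilators turns hyperplanes of `y` into lines of its dual.
  rw [← card_finrank_eq_one (V := Module.Dual F y) Subspace.dual_finrank_eq]
  congr 1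
  have e1 : {z : Submodule F V // z ⋖ y} ≃ {z : Submodule F y // Module.finrank F z + 1 =
      Module.finrank F y} := by
    refine ⟨fun z => ⟨z.1.comap y.subtype, ?_⟩, fun z => ⟨z.1.map y.subtype, ?_⟩, ?_, ?_⟩
    · obtain ⟨z, hz⟩ := z
      rw [Submodule.covBy_iff_le_and_finrank] at hz
      rw [(Submodule.comapSubtypeEquivOfLe hz.1).finrank_eq, hz.2]
    · rw [Submodule.covBy_iff_le_and_finrank, Submodule.finrank_map_subtype_eq, z.2]
      exact ⟨Submodule.map_subtype_le y z.1, rfl⟩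
    · rintro ⟨z, hz⟩
      simp [Submodule.map_comap_subtype, hz.le]
    · rintro ⟨z, hz⟩
      simp [Submodule.comap_map_eq_of_injective y.subtype_injective]
  refine Nat.card_congr (e1.trans ((Subspace.orderIsoFiniteDimensional.toEquiv.trans
    OrderDual.ofDual).subtypeEquiv fun z => ?_))
  have h1 : (Subspace.orderIsoFiniteDimensional.toEquiv.trans OrderDual.ofDual) z =
    z.dualAnnihilator := rfl
  rw [h1]
  have h2 := Subspace.finrank_add_finrank_dualAnnihilator_eq z
  omega

end SubspaceCounting

/-! ### Relations between raising, lowering and the covers outside the poset. -/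

namespace AttenuatedSpace

variable {F H : Type*} [Field F] [AddCommGroup H] [Module F H] {h : Submodule F H}

/-- The underlying subspace of a vertex. -/
def Vertex.space (y : Vertex h) : Submodule F H := Subtype.val y

lemma Vertex.space_inf (y : Vertex h) : y.space ⊓ h = ⊥ := Subtype.property y

/-- A subspace that meets `h` trivially, as a vertex. -/
def Vertex.ofSpace (w : Submodule F H) (hw : w ⊓ h = ⊥) : Vertex h := ⟨w, hw⟩

@[simp] lemma Vertex.space_ofSpace (w : Submodule F H) (hw : w ⊓ h = ⊥) :
    (Vertex.ofSpace w hw).space = w := rfl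

lemma Vertex.dim_eq (y : Vertex h) : y.dim = Module.finrank F y.space := rfl

lemma Vertex.space_injective : Function.Injective (Vertex.space (h := h)) :=
  Subtype.val_injective

lemma boole_mul_boole (p q : Prop) [Decidable p] [Decidable q] :
    (if p then (1 : ℂ) else 0) * (if q then 1 else 0) = if p ∧ q then 1 else 0 := by
  by_cases p <;> by_cases q <;> simp [*]

lemma Vertex.covBy_iff {y z : Vertex h} : y ⋖ z ↔ y.space ⋖ z.space := by
  refine ⟨fun hyz => ⟨hyz.lt, fun w h1 h2 => ?_⟩, fun hyz => ⟨hyz.lt, fun w h1 h2 => hyz.2 h1 h2⟩⟩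
  have hw : w ⊓ h = ⊥ := le_bot_iff.1 ((inf_le_inf_right h h2.le).trans z.space_inf.le)
  exact hyz.2 (c := ⟨w, hw⟩) h1 h2

lemma ne_bot_of_finrank_eq_one {l : Submodule F H} (hl : Module.finrank F l = 1) : l ≠ ⊥ := by
  rintro rfl
  simp at hl

variable [FiniteDimensional F H]

lemma Vertex.dim_of_covBy {y z : Vertex h} (hyz : y ⋖ z) : z.dim = y.dim + 1 :=
  (Submodule.covBy_iff_le_and_finrank.1 (Vertex.covBy_iff.1 hyz)).2

/-- A subspace that covers a vertex and meets `h` nontrivially meets `h` in a line. -/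
lemma Vertex.finrank_inf_eq_one {y : Vertex h} {w : Submodule F H} (hyw : y.space ⋖ w)
    (hw : w ⊓ h ≠ ⊥) : Module.finrank F ↥(w ⊓ h) = 1 := by
  have h1 := Submodule.covBy_iff_le_and_finrank.1 hyw
  have h2 := Submodule.finrank_sup_add_finrank_inf_eq (w ⊓ h) y.space
  have h3 : w ⊓ h ⊓ y.space = ⊥ := le_bot_iff.1 ((le_inf inf_le_right (inf_le_left.trans inf_le_right)).trans y.space_inf.le)
  have h4 : Module.finrank F ↥(w ⊓ h ⊔ y.space) ≤ Module.finrank F w :=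
    Submodule.finrank_mono (sup_le inf_le_left h1.1)
  have h5 : Module.finrank F ↥(w ⊓ h) ≠ 0 := fun h0 => hw (Submodule.finrank_eq_zero.1 h0)
  rw [h3, finrank_bot] at h2
  omega

/-- Joining a vertex `z` with a line of `h` gives a cover of `z`. -/
lemma Vertex.covBy_sup_line (z : Vertex h) {l : Submodule F H} (hl : l ≤ h)
    (hl1 : Module.finrank F l = 1) : z.space ⋖ z.space ⊔ l := by
  have h2 := Submodule.finrank_sup_add_finrank_inf_eq z.space l
  have h3 : z.space ⊓ l = ⊥ := le_bot_iff.1 ((inf_le_inf_left z.space hl).trans z.space_inf.le)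
  rw [h3, finrank_bot] at h2
  exact Submodule.covBy_iff_le_and_finrank.2 ⟨le_sup_left, by omega⟩

lemma Vertex.line_sup_eq {z : Vertex h} {w : Submodule F H} (hzw : z.space ⋖ w)
    (hw : w ⊓ h ≠ ⊥) : z.space ⊔ w ⊓ h = w := by
  have h1 := z.covBy_sup_line (l := w ⊓ h) inf_le_right (Vertex.finrank_inf_eq_one hzw hw)
  have h2 : z.space ⊔ w ⊓ h ≤ w := sup_le hzw.le inf_le_left
  exact h2.eq_or_lt.resolve_right fun hlt => hzw.2 h1.lt hlt

variable [Finite F]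

/-- A finite-dimensional space over a finite field has finitely many subspaces. -/
instance instFintypeSubmodule : Fintype (Submodule F H) :=
  haveI : Finite H := Module.finite_of_finite F
  Fintype.ofFinite _

variable (h) in
open Classical in
/-- The incidence matrix of "`w` covers `y`" between the vertices `y` and the
subspaces `w` that are not vertices. -/
def coverOutside : Matrix (Submodule F H) (Vertex h) ℂ :=
  Matrix.of fun w y => if y.space ⋖ w ∧ w ⊓ h ≠ ⊥ then 1 else 0

variable (h) in
/-- The `(y,z)`-entry is the number of subspaces covering `y` and `z` that are not vertices. -/
def outsideCount : Matrix (Vertex h) (Vertex h) ℂ := (coverOutside h).transpose * coverOutside h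

open Classical in
lemma sum_vertex (f : Submodule F H → ℂ) :
    ∑ z : Vertex h, f z.space = ∑ w, if w ⊓ h = ⊥ then f w else 0 := by
  rw [← Finset.sum_filter]
  symm
  exact Finset.sum_subtype (p := fun w => w ⊓ h = ⊥) _ (by simp) f

lemma sum_ite_one_eq_card {α : Type*} [Fintype α] (p : α → Prop) [DecidablePred p] :
    (∑ a, if p a then (1 : ℂ) else 0) = Nat.card {a // p a} := by
  rw [Finset.sum_boole, Nat.card_eq_fintype_card, Fintype.card_subtype]

open Classical in
-- Together, `LR` and `C` count the common covers of two vertices among all subspaces, while `RL`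
-- counts the subspaces covered by both; the latter are automatically vertices. Off the diagonal
-- both counts are 0 or 1 and agree by modularity. On the diagonal they are the numbers of covers
-- and of hyperplanes.
lemma lowering_mul_raising_add_outsideCount :
    lowering h * raising h + outsideCount h = raising h * lowering h +
      Matrix.diagonal fun y : Vertex h =>
        ((Nat.card F : ℂ) ^ (Module.finrank F H - y.dim) - 1) / ((Nat.card F : ℂ) - 1) -
        ((Nat.card F : ℂ) ^ y.dim - 1) / ((Nat.card F : ℂ) - 1) := by
  ext y y'
  have e1 : (lowering h * raising h) y y' + outsideCount h y y' =
      ∑ w, if y.space ⋖ w ∧ y'.space ⋖ w then (1 : ℂ) else 0 := by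
    rw [outsideCount, Matrix.mul_apply, Matrix.mul_apply]
    have := sum_vertex (h := h) (fun w => (if y.space ⋖ w ∧ y'.space ⋖ w then (1 : ℂ) else 0))
    simp only [lowering, raising, Matrix.of_apply, Vertex.covBy_iff, Matrix.transpose_apply,
      coverOutside, boole_mul_boole]
    rw [this, ← Finset.sum_add_distrib]
    refine Finset.sum_congr rfl fun w _ => ?_
    by_cases hw : w ⊓ h = ⊥ <;> simp [hw]
  have e2 : (raising h * lowering h) y y' =
      ∑ z : Submodule F H, if z ⋖ y.space ∧ z ⋖ y'.space then (1 : ℂ) else 0 := by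
    rw [Matrix.mul_apply]
    have := sum_vertex (h := h) (fun w => (if w ⋖ y.space ∧ w ⋖ y'.space then (1 : ℂ) else 0))
    simp only [lowering, raising, Matrix.of_apply, Vertex.covBy_iff, boole_mul_boole]
    rw [this]
    refine Finset.sum_congr rfl fun w _ => ?_
    by_cases hw : w ⋖ y.space
    · have : w ⊓ h = ⊥ := le_bot_iff.1 ((inf_le_inf_right h hw.le).trans y.space_inf.le)
      simp [this]
    · simp [hw]
  rw [Matrix.add_apply, Matrix.add_apply, e1, e2]
  by_cases hyy : y = y'
  · subst hyy
    simp only [and_self, Matrix.diagonal_apply_eq]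
    rw [sum_ite_one_eq_card, sum_ite_one_eq_card, card_covBy_left, card_covBy_right]
    simp only [Vertex.dim_eq]
    ring
  · have hne : y.space ≠ y'.space := fun he => hyy (Vertex.space_injective he)
    rw [Matrix.diagonal_apply_ne _ hyy, add_zero]
    rw [Finset.sum_eq_single (y.space ⊔ y'.space), Finset.sum_eq_single (y.space ⊓ y'.space)]
    · congr 1
      refine propext ⟨fun hc => ⟨hc.1.inf_of_sup_of_sup_left hc.2, hc.1.inf_of_sup_of_sup_right hc.2⟩,
        fun hc => ⟨hc.1.sup_of_inf_of_inf_left hc.2, hc.1.sup_of_inf_of_inf_right hc.2⟩⟩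
    · intro w _ hw
      rw [if_neg]
      rintro ⟨h1, h2⟩
      exact hw (h1.wcovBy.inf_eq h2.wcovBy hne).symm
    · simp
    · intro w _ hw
      rw [if_neg]
      rintro ⟨h1, h2⟩
      exact hw (h1.wcovBy.sup_eq h2.wcovBy hne).symm
    · simp

open Classical in
-- Of the `q + 1` subspaces strictly between `z` and `w`, exactly one fails to be a vertex: the join
-- of `z` with the line `w ⊓ h`.
lemma coverOutside_mul_raising (w : Submodule F H) (z : Vertex h) :
    (coverOutside h * raising h) w z =
      if z.space ≤ w ∧ Module.finrank F w = z.dim + 2 ∧ Module.finrank F ↥(w ⊓ h) = 1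
      then (Nat.card F : ℂ) else 0 := by
  rw [Matrix.mul_apply]
  simp only [coverOutside, raising, Matrix.of_apply, Vertex.covBy_iff, boole_mul_boole]
  split_ifs with hc
  · obtain ⟨hzw, hdim, hl⟩ := hc
    have hq : (Nat.card F : ℂ) - 1 ≠ 0 := by
      have : 1 < Nat.card F := Finite.one_lt_card
      exact sub_ne_zero.2 (by exact_mod_cast this.ne')
    have hcov : z.space ⋖ z.space ⊔ w ⊓ h := z.covBy_sup_line inf_le_right hl
    have hlw : z.space ⊔ w ⊓ h ≤ w := sup_le hzw inf_le_left
    rw [sum_vertex (fun y => if (y ⋖ w ∧ w ⊓ h ≠ ⊥) ∧ z.space ⋖ y then (1 : ℂ) else 0)]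
    trans ∑ y : Submodule F H, ((if z.space ⋖ y ∧ y ≤ w then (1 : ℂ) else 0) -
      if y = z.space ⊔ w ⊓ h then 1 else 0)
    · refine Finset.sum_congr rfl fun y _ => ?_
      by_cases hy : y = z.space ⊔ w ⊓ h
      · have hbad : y ⊓ h ≠ ⊥ := by
          subst hy
          intro hb
          apply ne_bot_of_finrank_eq_one hl
          rw [eq_bot_iff, ← hb]
          exact le_inf le_sup_right inf_le_right
        rw [if_neg hbad, if_pos ⟨hy ▸ hcov, hy ▸ hlw⟩, if_pos hy, sub_self]
      · rw [if_neg hy, sub_zero]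
        by_cases hzy : z.space ⋖ y ∧ y ≤ w
        · have hyw : y ⋖ w := by
            have h1 := Submodule.covBy_iff_le_and_finrank.1 hzy.1
            refine Submodule.covBy_iff_le_and_finrank.2 ⟨hzy.2, ?_⟩
            change Module.finrank F w = Module.finrank F z.space + 2 at hdim
            omega
          have hgood : y ⊓ h = ⊥ := by
            by_contra hb
            have h1 := Vertex.finrank_inf_eq_one hzy.1 hb
            have h2 : y ⊓ h = w ⊓ h := Submodule.eq_of_le_of_finrank_eq
              (inf_le_inf_right h hzy.2) (h1.trans hl.symm)
            exact hy (by rw [← h2, Vertex.line_sup_eq hzy.1 hb])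
          rw [if_pos hgood, if_pos ⟨⟨hyw, ne_bot_of_finrank_eq_one hl⟩, hzy.1⟩, if_pos hzy]
        · rw [if_neg hzy, ite_eq_right_iff]
          exact fun _ => if_neg fun hc => hzy ⟨hc.2, hc.1.1.le⟩
    · rw [Finset.sum_sub_distrib, sum_ite_one_eq_card, card_covBy_left_le hzw, hdim]
      simp only [Finset.sum_ite_eq', Finset.mem_univ, if_true, Vertex.dim_eq, add_tsub_cancel_left]
      field_simp
      ring
  · refine Finset.sum_eq_zero fun y _ => if_neg ?_
    rintro ⟨⟨h1, h2⟩, h3⟩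
    refine hc ⟨h3.le.trans h1.le, ?_, Vertex.finrank_inf_eq_one h1 h2⟩
    have h4 := Submodule.covBy_iff_le_and_finrank.1 h1
    have h5 := Submodule.covBy_iff_le_and_finrank.1 h3
    change Module.finrank F w = Module.finrank F z.space + 2
    omega

open Classical in
-- Since `w` is not a vertex it differs from `y`, so the only subspace that both can cover is `y ⊓
-- w`.
lemma raising_mul_transpose_coverOutside (y : Vertex h) (w : Submodule F H) :
    (raising h * (coverOutside h).transpose) y w =
      if (y.space ⊓ w ⋖ y.space ∧ y.space ⊓ w ⋖ w) ∧ w ⊓ h ≠ ⊥ then 1 else 0 := by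
  rw [Matrix.mul_apply]
  simp only [coverOutside, raising, Matrix.of_apply, Vertex.covBy_iff, boole_mul_boole, Matrix.transpose_apply]
  by_cases hw : w ⊓ h = ⊥
  · simp [hw]
  · have hyw : y.space ≠ w := fun he => hw (he ▸ y.space_inf)
    have hv : (y.space ⊓ w) ⊓ h = ⊥ := le_bot_iff.1 ((inf_le_inf_right h inf_le_left).trans y.space_inf.le)
    rw [Finset.sum_eq_single (Vertex.ofSpace (y.space ⊓ w) hv)]
    · simp [hw]
    · intro z _ hz
      rw [if_neg]
      rintro ⟨h1, h2, -⟩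
      exact hz (Vertex.space_injective (h1.wcovBy.inf_eq h2.wcovBy hyw).symm)
    · simp

/-- The factor `q` comes from `coverOutside_mul_raising`. What remains is a bijection between the
non-vertex covers `w` of `y` lying two levels above `z` and the non-vertex covers `w'` of `z` that
share a hyperplane with `y`. -/
lemma outsideCount_mul_raising :
    outsideCount h * raising h = (Nat.card F : ℂ) • (raising h * outsideCount h) := by
  classical
  ext y z
  rw [outsideCount, Matrix.smul_apply, Matrix.mul_assoc, ← Matrix.mul_assoc (raising h),
    Matrix.mul_apply, Matrix.mul_apply]
  simp only [coverOutside_mul_raising, raising_mul_transpose_coverOutside]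
  simp only [coverOutside, Matrix.transpose_apply, Matrix.of_apply]
  simp only [← mul_boole _ (Nat.card F : ℂ), mul_left_comm _ (Nat.card F : ℂ), boole_mul_boole,
    ← Finset.mul_sum, smul_eq_mul]
  congr 1
  rw [Finset.sum_boole, Finset.sum_boole]
  congr 1
  have key : ∀ w : Submodule F H, (y.space ⋖ w ∧ w ⊓ h ≠ ⊥) ∧
      (z.space ≤ w ∧ Module.finrank F w = z.dim + 2 ∧ Module.finrank F ↥(w ⊓ h) = 1) →
      z.space ⋖ z.space ⊔ w ⊓ h ∧ (z.space ⊔ w ⊓ h) ⊓ h ≠ ⊥ ∧ z.space ⊔ w ⊓ h ⋖ w ∧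
        y.space ⊔ (z.space ⊔ w ⊓ h) = w := by
    rintro w ⟨⟨hyw, hw⟩, hzw, hdim, hl⟩
    have hcov : z.space ⋖ z.space ⊔ w ⊓ h := z.covBy_sup_line inf_le_right hl
    have hbad : (z.space ⊔ w ⊓ h) ⊓ h ≠ ⊥ := fun hb =>
      hw (eq_bot_iff.2 (hb ▸ le_inf le_sup_right inf_le_right))
    have hcw : z.space ⊔ w ⊓ h ⋖ w := by
      have h1 := Submodule.covBy_iff_le_and_finrank.1 hcov
      refine Submodule.covBy_iff_le_and_finrank.2 ⟨sup_le hzw inf_le_left, ?_⟩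
      change Module.finrank F w = Module.finrank F z.space + 2 at hdim
      omega
    exact ⟨hcov, hbad, hcw, hyw.wcovBy.sup_eq hcw.wcovBy fun he => hbad (he ▸ y.space_inf)⟩
  -- Going back recovers the same subspace because `w` and `y ⊔ w` meet `h` in the same line, and
  -- `z` together with that line spans `w`.
  refine Finset.card_bij' (fun w _ => z.space ⊔ w ⊓ h) (fun w _ => y.space ⊔ w) ?_ ?_ ?_ ?_
  · intro w hw
    rw [Finset.mem_filter] at hw
    obtain ⟨h1, h2, h3, h4⟩ := key w hw.2
    rw [Finset.mem_filter]
    refine ⟨Finset.mem_univ _, ⟨⟨?_, ?_⟩, h2⟩, h1, h2⟩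
    · exact CovBy.inf_of_sup_right (by rw [h4]; exact h3)
    · exact CovBy.inf_of_sup_left (by rw [h4]; exact hw.2.1.1)
  · intro w hw
    rw [Finset.mem_filter] at hw ⊢
    obtain ⟨-, ⟨⟨h1, h2⟩, h3⟩, h4, -⟩ := hw
    have hyw : y.space ⋖ y.space ⊔ w := h2.sup_of_inf_right
    have hwy : w ⋖ y.space ⊔ w := h1.sup_of_inf_left
    have hbad : (y.space ⊔ w) ⊓ h ≠ ⊥ := fun hb =>
      h3 (eq_bot_iff.2 (hb ▸ inf_le_inf_right h le_sup_right))
    refine ⟨Finset.mem_univ _, ⟨hyw, hbad⟩, h4.le.trans le_sup_right, ?_,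
      Vertex.finrank_inf_eq_one hyw hbad⟩
    have h5 := Submodule.covBy_iff_le_and_finrank.1 hwy
    have h6 := Submodule.covBy_iff_le_and_finrank.1 h4
    rw [Vertex.dim_eq]
    omega
  · intro w hw
    rw [Finset.mem_filter] at hw
    exact (key w hw.2).2.2.2
  · intro w hw
    rw [Finset.mem_filter] at hw
    obtain ⟨-, ⟨⟨h1, h2⟩, h3⟩, h4, -⟩ := hw
    have hyw : y.space ⋖ y.space ⊔ w := h2.sup_of_inf_right
    have hbad : (y.space ⊔ w) ⊓ h ≠ ⊥ := fun hb =>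
      h3 (eq_bot_iff.2 (hb ▸ inf_le_inf_right h le_sup_right))
    have he : w ⊓ h = (y.space ⊔ w) ⊓ h := Submodule.eq_of_le_of_finrank_eq
      (inf_le_inf_right h le_sup_right)
      ((Vertex.finrank_inf_eq_one h4 h3).trans (Vertex.finrank_inf_eq_one hyw hbad).symm)
    rw [← he, Vertex.line_sup_eq h4 h3]

end AttenuatedSpace

/-! ### Eigenbases, split forms and Leonard systems. -/

section LeonardTheory

open Module

variable {K W : Type*} [Field K] [AddCommGroup W] [Module K W]

section Eigenbasis

variable {d : ℕ} {A : End K W} (b : Basis (Fin (d + 1)) K W) {θ : Fin (d + 1) → K}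

lemma repr_apply_of_eigenbasis (hb : ∀ i, A (b i) = θ i • b i) (x : W) (i : Fin (d + 1)) :
    b.repr (A x) i = θ i * b.repr x i := by
  have : b.coord i ∘ₗ A = θ i • b.coord i := by
    refine b.ext fun j => ?_
    by_cases hij : j = i
    · subst hij; simp [hb]
    · simp [hb, hij]
  simpa using LinearMap.congr_fun this x

lemma mem_eigenspace_iff_of_eigenbasis (hb : ∀ i, A (b i) = θ i • b i)
    (hθ : Function.Injective θ) (i : Fin (d + 1)) (x : W) :
    x ∈ A.eigenspace (θ i) ↔ b.repr x i • b i = x := by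
  rw [End.mem_eigenspace_iff]
  constructor
  · intro hx
    apply b.repr.injective
    ext j
    by_cases hij : i = j
    · subst hij; simp
    · have h1 := repr_apply_of_eigenbasis b hb x j
      rw [hx] at h1
      have h2 : (θ i - θ j) * b.repr x j = 0 := by
        simp only [map_smul, Finsupp.smul_apply, smul_eq_mul] at h1
        linear_combination h1
      have h3 : b.repr x j = 0 :=
        (mul_eq_zero.1 h2).resolve_left (sub_ne_zero.2 fun h => hij (hθ h))
      simp [hij, h3]
  · intro hx
    rw [← hx, map_smul, hb, smul_comm]

lemma hasEigenvalue_iff_of_eigenbasis (hb : ∀ i, A (b i) = θ i • b i) (μ : K) :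
    A.HasEigenvalue μ ↔ μ ∈ Set.range θ := by
  constructor
  · intro hμ
    obtain ⟨x, hx⟩ := hμ.exists_hasEigenvector
    obtain ⟨i, hi⟩ : ∃ i, b.repr x i ≠ 0 := by
      by_contra! hc
      exact hx.2 (b.repr.injective (by ext i; simp [hc i]))
    refine ⟨i, ?_⟩
    have h1 := repr_apply_of_eigenbasis b hb x i
    rw [hx.apply_eq_smul, map_smul, Finsupp.smul_apply, smul_eq_mul] at h1
    exact (mul_right_cancel₀ hi h1).symm
  · rintro ⟨i, rfl⟩
    exact End.hasEigenvalue_of_hasEigenvector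
      ⟨End.mem_eigenspace_iff.2 (hb i), b.ne_zero i⟩

lemma isMultiplicityFree_of_eigenbasis (hb : ∀ i, A (b i) = θ i • b i)
    (hθ : Function.Injective θ) : IsMultiplicityFree A := by
  constructor
  · rw [eq_top_iff, ← b.span_eq, Submodule.span_le]
    rintro _ ⟨i, rfl⟩
    exact Submodule.mem_iSup_of_mem (θ i) (End.mem_eigenspace_iff.2 (hb i))
  · intro μ hμ
    obtain ⟨i, rfl⟩ := (hasEigenvalue_iff_of_eigenbasis b hb μ).1 hμ
    refine finrank_eq_one_iff'.2
      ⟨⟨b i, End.mem_eigenspace_iff.2 (hb i)⟩, fun h => b.ne_zero i (congrArg Subtype.val h), ?_⟩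
    rintro ⟨x, hx⟩
    exact ⟨b.repr x i, Subtype.ext ((mem_eigenspace_iff_of_eigenbasis b hb hθ i x).1 hx)⟩

/-- A primitive idempotent is determined by its effect on the eigenvectors. -/
lemma primitiveIdempotent_apply_of_mem {A : End K W} (hA : (⨆ μ : K, A.eigenspace μ) = ⊤)
    (μ ν : K) {x : W} (hx : A x = ν • x) :
    (μ = ν → primitiveIdempotent A μ x = x) ∧ (μ ≠ ν → primitiveIdempotent A μ x = 0) := by
  have hc : IsCompl (A.eigenspace μ) (⨆ ν : K, ⨆ _ : ν ≠ μ, A.eigenspace ν) := by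
    refine ⟨A.eigenspaces_iSupIndep μ, ?_⟩
    rw [codisjoint_iff, eq_top_iff, ← hA]
    refine iSup_le fun ν => ?_
    by_cases h : ν = μ
    · subst h; exact le_sup_left
    · exact le_sup_of_le_right (le_iSup_of_le ν (le_iSup_of_le h le_rfl))
  rw [primitiveIdempotent, dif_pos hc]
  constructor
  · rintro rfl
    exact Submodule.projection_apply_of_mem_left hc (End.mem_eigenspace_iff.2 hx)
  · intro h
    refine Submodule.projection_apply_of_mem_right hc ?_
    exact Submodule.mem_iSup_of_mem ν (Submodule.mem_iSup_of_mem (Ne.symm h)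
      (End.mem_eigenspace_iff.2 hx))

lemma primitiveIdempotent_apply_of_eigenbasis (hb : ∀ i, A (b i) = θ i • b i)
    (hθ : Function.Injective θ) (i : Fin (d + 1)) (x : W) :
    primitiveIdempotent A (θ i) x = b.repr x i • b i := by
  have hA := (isMultiplicityFree_of_eigenbasis b hb hθ).1
  have : primitiveIdempotent A (θ i) = (b.coord i).smulRight (b i) := by
    refine b.ext fun j => ?_
    have h1 := primitiveIdempotent_apply_of_mem hA (θ i) (θ j) (hb j)
    by_cases hij : i = j
    · subst hij; simp [h1.1 rfl]
    · rw [h1.2 fun h => hij (hθ h)]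
      simp [Ne.symm hij]
  simpa using LinearMap.congr_fun this x

lemma isEigenvalueSequence_of_eigenbasis (hb : ∀ i, A (b i) = θ i • b i)
    (hθ : Function.Injective θ) :
    IsEigenvalueSequence A (fun i => primitiveIdempotent A (θ i)) θ :=
  ⟨hθ, by ext μ; exact (hasEigenvalue_iff_of_eigenbasis b hb μ).symm, fun _ => rfl⟩

lemma actsIrreduciblyTridiagonally_of_eigenbasis (hb : ∀ i, A (b i) = θ i • b i)
    (hθ : Function.Injective θ) {B : End K W}
    (hB : IsIrreducibleTridiagonal (LinearMap.toMatrix b b B)) :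
    ActsIrreduciblyTridiagonally (fun i => primitiveIdempotent A (θ i)) B := by
  have key : ∀ i j x, (primitiveIdempotent A (θ i) * B * primitiveIdempotent A (θ j)) x =
      (b.repr x j * LinearMap.toMatrix b b B i j) • b i := by
    intro i j x
    simp only [Module.End.mul_apply, primitiveIdempotent_apply_of_eigenbasis b hb hθ, map_smul,
      LinearMap.toMatrix_apply, mul_smul]
  refine fun i j => ⟨fun hij => ?_, fun hij h0 => ?_⟩
  · ext x
    rw [key, (hB i j).1 hij, mul_zero, zero_smul, LinearMap.zero_apply]
  · have h1 := key i j (b j)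
    rw [h0, LinearMap.zero_apply, Basis.repr_self, Finsupp.single_eq_same, one_mul] at h1
    exact (smul_ne_zero ((hB i j).2 hij) (b.ne_zero i)) h1.symm

lemma toMatrix_isDiag_of_eigenbasis (hb : ∀ i, A (b i) = θ i • b i) :
    (LinearMap.toMatrix b b A).IsDiag := by
  intro i j hij
  simp [LinearMap.toMatrix_apply, hb, Ne.symm hij]

end Eigenbasis

section Split

variable {d : ℕ} {A As : End K W} {θ θs : Fin (d + 1) → K} {φ : ℕ → K}

lemma IsSplitSequence.exists_eigenbasis (hs : IsSplitSequence A As θ θs φ)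
    (hθ : Function.Injective θ) :
    ∃ w : Basis (Fin (d + 1)) K W, ∀ i, A (w i) = θ i • w i := by
  obtain ⟨u, hu⟩ := hs
  have : FiniteDimensional K W := u.finiteDimensional_of_finite
  -- In the split basis `θ i - A` is lower triangular with a zero on the diagonal, hence singular.
  have hev : ∀ i, A.HasEigenvalue (θ i) := by
    intro i
    rw [End.hasEigenvalue_iff_mem_spectrum, spectrum.mem_iff]
    intro hunit
    have hM : LinearMap.toMatrix u u (algebraMap K (End K W) (θ i) - A) =
        Matrix.of fun k j => if k = j then θ i - θ k else if (k : ℕ) = j + 1 then -1 else 0 := by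
      ext k j
      rw [map_sub, Matrix.sub_apply, (hu k j).1, LinearMap.toMatrix_algebraMap,
        Matrix.scalar_apply, Matrix.diagonal_apply, Matrix.of_apply]
      split_ifs <;> simp
    have hdet : LinearMap.det (algebraMap K (End K W) (θ i) - A) = 0 := by
      rw [← LinearMap.det_toMatrix u, hM, Matrix.det_of_isLowerTriangular]
      · exact Finset.prod_eq_zero (Finset.mem_univ i) (by simp)
      · intro k j hkj
        have hkj' : k < j := hkj
        rw [Matrix.of_apply, if_neg hkj'.ne, if_neg]
        have : (k : ℕ) < j := hkj'
        omega
    have h2 := hunit.map LinearMap.det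
    rw [hdet] at h2
    exact not_isUnit_zero h2
  choose x hx using fun i => (hev i).exists_hasEigenvector
  have hli := End.eigenvectors_linearIndependent' A θ hθ x hx
  refine ⟨basisOfLinearIndependentOfCardEqFinrank hli (finrank_eq_card_basis u).symm, fun i => ?_⟩
  simp [(hx i).apply_eq_smul]

/-- The action of `As` on an eigenbasis of `A`, seen from a split basis. -/
lemma IsSplitSequence.repr_eigenbasis (hs : IsSplitSequence A As θ θs φ)
    (hθ : Function.Injective θ) (hφ : ∀ i, 1 ≤ i → i ≤ d → φ i ≠ 0)
    (w : Basis (Fin (d + 1)) K W) (hw : ∀ i, A (w i) = θ i • w i) (i j : Fin (d + 1)) :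
    ((j : ℕ) + 1 < i → w.repr (As (w i)) j = 0) ∧
    ((j : ℕ) + 1 = i → w.repr (As (w i)) j ≠ 0) := by
  obtain ⟨u, hu⟩ := hs
  have hAu : ∀ k, A (u k) = ∑ l, LinearMap.toMatrix u u A l k • u l := fun k => by
    simp only [LinearMap.toMatrix_apply, Basis.sum_repr]
  have hAsu : ∀ k, As (u k) = ∑ l, LinearMap.toMatrix u u As l k • u l := fun k => by
    simp only [LinearMap.toMatrix_apply, Basis.sum_repr]
  -- The change of basis is triangular both ways: `w i` lies in the span of the `u k` with `k ≥ i`,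
  -- and (`hb`) `u k` lies in the span of the `w j` with `j ≥ k`.
  have ha : ∀ i k, k < i → u.repr (w i) k = 0 := by
    intro i k
    induction k using WellFoundedLT.induction with
    | ind k ih =>
      intro hki
      have h1 := congrFun (LinearMap.toMatrix_mulVec_repr u u A (w i)) k
      rw [hw, map_smul, Finsupp.smul_apply, Matrix.mulVec, dotProduct,
        Finset.sum_eq_single k, (hu k k).1, if_pos rfl, smul_eq_mul] at h1
      · have h2 : (θ k - θ i) * u.repr (w i) k = 0 := by linear_combination h1
        exact (mul_eq_zero.1 h2).resolve_left (sub_ne_zero.2 fun h => hki.ne (hθ h))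
      · intro l _ hl
        by_cases hkl : (k : ℕ) = l + 1
        · have hlk : l < k := by rw [Fin.lt_def]; omega
          rw [ih l hlk (hlk.trans hki), mul_zero]
        · rw [(hu k l).1, if_neg (Ne.symm hl), if_neg hkl, zero_mul]
      · simp
  have hb : ∀ j k, j < k → w.repr (u k) j = 0 := by
    intro j k
    induction k using WellFoundedGT.induction with
    | ind k ih =>
      intro hjk
      have h1 := repr_apply_of_eigenbasis w hw (u k) j
      rw [hAu, map_sum, Finsupp.finsetSum_apply, Finset.sum_eq_single k, (hu k k).1, if_pos rfl,
        map_smul, Finsupp.smul_apply, smul_eq_mul] at h1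
      · have h2 : (θ k - θ j) * w.repr (u k) j = 0 := by linear_combination h1
        exact (mul_eq_zero.1 h2).resolve_left (sub_ne_zero.2 fun h => hjk.ne' (hθ h))
      · intro l _ hl
        by_cases hkl : (l : ℕ) = k + 1
        · have hlk : k < l := by rw [Fin.lt_def]; omega
          rw [map_smul, Finsupp.smul_apply, ih l hlk (hjk.trans hlk), smul_zero]
        · rw [(hu l k).1, if_neg hl, if_neg hkl, zero_smul, map_zero, Finsupp.zero_apply]
      · simp
  -- The two triangular transition matrices are mutually inverse, so their diagonal entries are
  -- nonzero.
  have hab : ∀ j, u.repr (w j) j * w.repr (u j) j = 1 := by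
    intro j
    have h1 : w.repr (w j) j = 1 := by simp
    conv_lhs at h1 => rw [← u.sum_repr (w j)]
    rw [map_sum, Finsupp.finsetSum_apply, Finset.sum_eq_single j] at h1
    · simpa using h1
    · intro k _ hk
      rcases lt_or_gt_of_ne hk with h | h
      · simp [ha j k h]
      · simp [hb j k h]
    · simp
  have hexp : w.repr (As (w i)) j = ∑ k, ∑ l, u.repr (w i) k *
      (LinearMap.toMatrix u u As l k * w.repr (u l) j) := by
    conv_lhs => rw [← u.sum_repr (w i)]
    simp only [map_sum, map_smul, hAsu, Finsupp.finsetSum_apply, Finsupp.smul_apply, smul_eq_mul,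
      Finset.mul_sum]
  -- `As` lowers the split index by at most one, so few terms survive. For `j + 1 = i` only `k = i`,
  -- `l = j` remains, and it contributes `φ i` times two nonzero diagonal entries.
  have hzero : ∀ k l, ¬ (i ≤ k ∧ l ≤ j ∧ (k : ℕ) ≤ l + 1) → u.repr (w i) k *
      (LinearMap.toMatrix u u As l k * w.repr (u l) j) = 0 := by
    intro k l hkl
    by_cases h1 : k < i
    · rw [ha i k h1, zero_mul]
    by_cases h2 : j < l
    · rw [hb j l h2, mul_zero, mul_zero]
    rw [(hu l k).2, if_neg, if_neg, zero_mul, mul_zero]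
    · exact fun h => hkl ⟨not_lt.1 h1, not_lt.1 h2, h.le⟩
    · rintro rfl
      exact hkl ⟨not_lt.1 h1, not_lt.1 h2, by omega⟩
  constructor
  · intro hji
    rw [hexp]
    refine Finset.sum_eq_zero fun k _ => Finset.sum_eq_zero fun l _ => hzero k l ?_
    rintro ⟨h1, h2, h3⟩
    have h1' : (i : ℕ) ≤ k := h1
    have h2' : (l : ℕ) ≤ j := h2
    omega
  · intro hji
    rw [hexp, Finset.sum_eq_single i, Finset.sum_eq_single j]
    · rw [(hu j i).2, if_neg (by rintro rfl; omega), if_pos hji.symm]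
      exact mul_ne_zero (left_ne_zero_of_mul_eq_one (hab i))
        (mul_ne_zero (hφ i (by omega) (by omega)) (right_ne_zero_of_mul_eq_one (hab j)))
    · intro l _ hl
      refine hzero i l ?_
      rintro ⟨h1, h2, h3⟩
      have h2' : (l : ℕ) ≤ j := h2
      exact hl (Fin.ext (by omega))
    · simp
    · intro k _ hk
      refine Finset.sum_eq_zero fun l _ => hzero k l ?_
      rintro ⟨h1, h2, h3⟩
      have h1' : (i : ℕ) ≤ k := h1
      have h2' : (l : ℕ) ≤ j := h2
      exact hk (Fin.ext (by omega))
    · simp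

end Split

section OfSplit

variable {d : ℕ} {A As : End K W} {θ θs : Fin (d + 1) → K} {φ ψ : ℕ → K}

/-- Both split forms together make `As` irreducible tridiagonal on an eigenbasis of `A`. -/
lemma isIrreducibleTridiagonal_of_isSplitSequence (hs : IsSplitSequence A As θ θs φ)
    (hs' : IsSplitSequence A As (fun i => θ i.rev) θs ψ) (hθ : Function.Injective θ)
    (hφ : ∀ i, 1 ≤ i → i ≤ d → φ i ≠ 0) (hψ : ∀ i, 1 ≤ i → i ≤ d → ψ i ≠ 0)
    (w : Basis (Fin (d + 1)) K W) (hw : ∀ i, A (w i) = θ i • w i) :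
    IsIrreducibleTridiagonal (LinearMap.toMatrix w w As) := by
  intro i j
  rw [LinearMap.toMatrix_apply]
  have h1 := hs.repr_eigenbasis hθ hφ w hw j i
  -- One split form controls only the entries above the diagonal; the reversed order supplies those
  -- below it.
  have h2 := hs'.repr_eigenbasis (hθ.comp Fin.rev_injective) hψ (w.reindex Fin.revPerm)
    (fun k => by simp [hw]) j.rev i.rev
  simp only [Basis.reindex_apply, Basis.repr_reindex_apply, Fin.revPerm_symm, Fin.revPerm_apply,
    Fin.rev_rev, Fin.val_rev] at h2
  have hi := i.2
  have hj := j.2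
  exact ⟨fun hc => hc.elim (fun hc => h1.1 hc) fun hc => h2.1 (by omega),
    fun hc => hc.elim (fun hc => h1.2 hc) fun hc => h2.2 (by omega)⟩

lemma isLeonardPair_of_bases (v w : Basis (Fin (d + 1)) K W)
    (hv : ∀ i, As (v i) = θs i • v i) (hw : ∀ i, A (w i) = θ i • w i)
    (hA : IsIrreducibleTridiagonal (LinearMap.toMatrix v v A))
    (hAs : IsIrreducibleTridiagonal (LinearMap.toMatrix w w As)) : IsLeonardPair A As := by
  have hfin : finrank K W = d + 1 := by simp [finrank_eq_card_basis v]
  have key : ∀ (b : Basis (Fin (d + 1)) K W) (B : End K W) (i j : Fin (finrank K W)),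
      LinearMap.toMatrix (b.reindex (finCongr hfin.symm)) (b.reindex (finCongr hfin.symm)) B i j =
        LinearMap.toMatrix b b B (finCongr hfin i) (finCongr hfin j) := by
    intro b B i j
    simp [LinearMap.toMatrix_apply]
  refine ⟨by omega, ⟨w.reindex (finCongr hfin.symm), fun i j hij => ?_, fun i j => ?_⟩,
    ⟨v.reindex (finCongr hfin.symm), fun i j hij => ?_, fun i j => ?_⟩⟩
  · refine (key _ _ i j).trans ?_
    exact toMatrix_isDiag_of_eigenbasis w hw fun h => hij ((finCongr hfin).injective h)
  · rw [key]
    exact hAs (finCongr hfin i) (finCongr hfin j)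
  · refine (key _ _ i j).trans ?_
    exact toMatrix_isDiag_of_eigenbasis v hv fun h => hij ((finCongr hfin).injective h)
  · rw [key]
    exact hA (finCongr hfin i) (finCongr hfin j)

/-- A pair of linear maps with both split forms is a Leonard system. -/
theorem exists_leonardSystem_of_isSplitSequence (v : Basis (Fin (d + 1)) K W)
    (hv : ∀ i, As (v i) = θs i • v i) (hθs : Function.Injective θs)
    (hA : IsIrreducibleTridiagonal (LinearMap.toMatrix v v A))
    (hs : IsSplitSequence A As θ θs φ)
    (hs' : IsSplitSequence A As (fun i => θ i.rev) θs ψ) (hθ : Function.Injective θ)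
    (hφ : ∀ i, 1 ≤ i → i ≤ d → φ i ≠ 0) (hψ : ∀ i, 1 ≤ i → i ≤ d → ψ i ≠ 0) :
    ∃ Φ : LeonardSystem K W d, Φ.A = A ∧ Φ.As = As ∧ Φ.IsParameterArray θ θs φ ψ ∧
      IsMultiplicityFree A ∧ IsLeonardPair A As := by
  obtain ⟨w, hw⟩ := hs.exists_eigenbasis hθ
  have hAs := isIrreducibleTridiagonal_of_isSplitSequence hs hs' hθ hφ hψ w hw
  have e1 := isEigenvalueSequence_of_eigenbasis w hw hθ
  have e2 := isEigenvalueSequence_of_eigenbasis v hv hθs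
  exact ⟨⟨A, _, As, _, isMultiplicityFree_of_eigenbasis w hw hθ,
    isMultiplicityFree_of_eigenbasis v hv hθs, ⟨θ, e1⟩, ⟨θs, e2⟩,
    actsIrreduciblyTridiagonally_of_eigenbasis w hw hθ hAs,
    actsIrreduciblyTridiagonally_of_eigenbasis v hv hθs hA⟩, rfl, rfl, ⟨e1, e2, hs, hs'⟩,
    isMultiplicityFree_of_eigenbasis w hw hθ, isLeonardPair_of_bases v w hv hw hA hAs⟩

end OfSplit

/-! ### Ladders and the Askey-Wilson relation. -/

section Ladder

/-- The product of the off-diagonal entries of `A` at position `k`. -/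
def ladderWeight (q κ : K) (d k : ℕ) : K :=
  κ ^ 2 * (q ^ k - 1) * (q ^ (d + 1) - q ^ k) / (q * (q - 1) ^ 2)

/-- The eigenvalues of `A`. -/
def ladderEigenvalue (q κ : K) (d i : ℕ) : K := κ * (q ^ d / q ^ i - q ^ i) / (q - 1)

/-- The entries of the split form of `As`. -/
def ladderSplit (q κ ρ : K) (d i : ℕ) : K :=
  κ * ρ * (1 - q ^ i) * (q ^ (d + 1) - q ^ i) / ((q - 1) * (q ^ i) ^ 2)

/-- Maps `A`, `As` acting on a chain of vectors `v 0, …, v d` by a weighted walk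
and by a `q`-scaling. -/
structure IsLadder (q κ ρ : K) (d : ℕ) (A As : End K W) (v : ℕ → W) : Prop where
  apply : ∀ k, A (v k) = v (k + 1) + ladderWeight q κ d k • v (k - 1)
  dual_apply : ∀ k, As (v k) = (ρ / q ^ k) • v k
  eq_zero : ∀ k, d < k → v k = 0

/-- The split vectors of a ladder. -/
def ladderSplitVector (q κ : K) (d : ℕ) (A : End K W) (v : ℕ → W) : ℕ → W
  | 0 => v 0
  | i + 1 => A (ladderSplitVector q κ d A v i) -
      ladderEigenvalue q κ d i • ladderSplitVector q κ d A v i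

variable {q κ ρ : K} {d : ℕ} {A As : End K W} {v : ℕ → W}

/-- The weights see only `κ ^ 2`. With `ladderEigenvalue_rev`, this yields the second split form
from the first. -/
lemma IsLadder.neg (hL : IsLadder q κ ρ d A As v) : IsLadder q (-κ) ρ d A As v where
  apply k := by rw [hL.apply, ladderWeight, ladderWeight, neg_sq]
  dual_apply := hL.dual_apply
  eq_zero := hL.eq_zero

lemma ladderSplitVector_apply (q κ : K) (d : ℕ) (A : End K W) (v : ℕ → W) (i : ℕ) :
    A (ladderSplitVector q κ d A v i) = ladderSplitVector q κ d A v (i + 1) +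
      ladderEigenvalue q κ d i • ladderSplitVector q κ d A v i := by
  rw [ladderSplitVector, sub_add_cancel]

/-- The Askey-Wilson relation between `A` and `As`. -/
lemma IsLadder.askeyWilson (hL : IsLadder q κ ρ d A As v) (hq : q ≠ 0) (hq1 : q ≠ 1) (k : ℕ) :
    As (A (A (v k))) = (q + q⁻¹) • A (As (A (v k))) - A (A (As (v k))) +
      (κ ^ 2 * (q + 1) ^ 2 * q ^ d / q ^ 2) • As (v k)
      - (κ ^ 2 * ρ * (q + 1) * (q ^ (d + 1) + 1) / q ^ 2) • v k := by
  have hq1' : q - 1 ≠ 0 := sub_ne_zero.2 hq1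
  -- Two applications of `A` reach `v (k - 2)`. The truncated indices at `k = 0, 1` are harmless
  -- because `ladderWeight` vanishes at 0.
  rcases k with _ | _ | k
  · simp only [hL.apply, hL.dual_apply, map_add, map_smul, ladderWeight]
    match_scalars <;> field_simp <;> ring
  · simp only [hL.apply, hL.dual_apply, map_add, map_smul, ladderWeight]
    match_scalars <;> field_simp <;> ring
  · simp only [hL.apply, hL.dual_apply, map_add, map_smul, ladderWeight, Nat.add_sub_cancel,
      show k + 1 + 1 - 1 = k + 1 from rfl, show k + 1 - 1 = k from rfl]
    match_scalars <;> field_simp <;> ring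

lemma IsLadder.askeyWilson_apply (hL : IsLadder q κ ρ d A As v)
    (hspan : Submodule.span K (Set.range v) = ⊤) (hq : q ≠ 0) (hq1 : q ≠ 1) (x : W) :
    As (A (A x)) = (q + q⁻¹) • A (As (A x)) - A (A (As x)) +
      (κ ^ 2 * (q + 1) ^ 2 * q ^ d / q ^ 2) • As x
      - (κ ^ 2 * ρ * (q + 1) * (q ^ (d + 1) + 1) / q ^ 2) • x := by
  have hx : x ∈ Submodule.span K (Set.range v) := hspan ▸ Submodule.mem_top
  induction hx using Submodule.span_induction with
  | mem y hy => obtain ⟨k, rfl⟩ := hy; exact hL.askeyWilson hq hq1 k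
  | zero => simp
  | add y z _ _ hy hz => simp only [map_add, hy, hz]; module
  | smul c y _ hy => simp only [map_smul, hy]; module

lemma ladderSplit_zero : ladderSplit q κ ρ d 0 = 0 := by simp [ladderSplit]

/-- The Askey-Wilson relation expresses `As A^2` through words with at most one `A` to the right of
`As`. Since `u (i + 2)` is a quadratic polynomial in `A` applied to `u i`, the action of `As` on it
follows from the action on `u i` and `u (i + 1)`. -/
lemma IsLadder.dual_splitVector (hL : IsLadder q κ ρ d A As v)
    (hspan : Submodule.span K (Set.range v) = ⊤) (hq : q ≠ 0) (hq1 : q ≠ 1) (i : ℕ) :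
    As (ladderSplitVector q κ d A v i) = (ρ / q ^ i) • ladderSplitVector q κ d A v i +
      ladderSplit q κ ρ d i • ladderSplitVector q κ d A v (i - 1) := by
  have hq1' : q - 1 ≠ 0 := sub_ne_zero.2 hq1
  have hA := ladderSplitVector_apply q κ d A v
  induction i using Nat.twoStepInduction with
  | zero => simp [ladderSplitVector, hL.dual_apply, ladderSplit]
  | one =>
    have h0 : ladderSplitVector q κ d A v 1 = v 1 - ladderEigenvalue q κ d 0 • v 0 := by
      simp [ladderSplitVector, hL.apply, ladderWeight]
    have h1 : ladderSplitVector q κ d A v 0 = v 0 := rfl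
    simp only [h0, Nat.sub_self, h1, map_sub, map_smul, hL.dual_apply, ladderEigenvalue,
      ladderSplit]
    match_scalars <;> field_simp
    ring
  | more i ih0 ih1 =>
    have hAW := hL.askeyWilson_apply hspan hq hq1 (ladderSplitVector q κ d A v i)
    have h2 : ladderSplitVector q κ d A v (i + 2) = A (A (ladderSplitVector q κ d A v i)) -
        (ladderEigenvalue q κ d i + ladderEigenvalue q κ d (i + 1)) •
          A (ladderSplitVector q κ d A v i) +
        (ladderEigenvalue q κ d i * ladderEigenvalue q κ d (i + 1)) •
          ladderSplitVector q κ d A v i := by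
      simp only [hA, map_add, map_smul]
      module
    rw [show i + 2 - 1 = i + 1 from rfl]
    conv_lhs => rw [h2]
    rw [map_add, map_sub, hAW]
    rw [show i + 1 - 1 = i from rfl] at ih1
    -- At `i = 0` the vector `u (i - 1)` does not exist, and its coefficient is zero.
    rcases i with _ | i
    · rw [ladderSplit_zero, zero_smul, add_zero] at ih0
      simp only [hA, ih0, ih1, map_add, map_smul, ladderEigenvalue, ladderSplit]
      match_scalars <;> field_simp <;> ring
    · rw [show i + 1 - 1 = i from rfl] at ih0
      simp only [hA, ih0, ih1, map_add, map_smul, ladderEigenvalue, ladderSplit]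
      match_scalars <;> field_simp <;> ring

end Ladder

/-! ### The split basis of a ladder. -/

section LadderSystem

variable {q κ ρ : K} {d : ℕ} {A As : End K W} {v : ℕ → W}

lemma div_pow_inj (hρ : ρ ≠ 0) {x y : K} (h : ρ / x = ρ / y) : x = y := by
  rw [div_eq_mul_inv, div_eq_mul_inv] at h
  exact inv_injective (mul_left_cancel₀ hρ h)

/-- Coordinates of a finite chain with respect to the basis it forms. -/
lemma repr_chain (b : Basis (Fin (d + 1)) K W) {f : ℕ → W} (hb : ∀ i : Fin (d + 1), b i = f i)
    {n : ℕ} (hf : d < n → f n = 0) (i : Fin (d + 1)) :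
    b.repr (f n) i = if (i : ℕ) = n then 1 else 0 := by
  by_cases hn : n < d + 1
  · have h1 := hb ⟨n, hn⟩
    rw [← h1, Basis.repr_self, Finsupp.single_apply]
    simp only [Fin.ext_iff, eq_comm]
  · rw [hf (by omega), if_neg (by omega)]
    simp

lemma span_range_chain (b : Basis (Fin (d + 1)) K W) (hb : ∀ i : Fin (d + 1), b i = v i) :
    Submodule.span K (Set.range v) = ⊤ := by
  rw [eq_top_iff, ← b.span_eq, Submodule.span_le]
  rintro _ ⟨i, rfl⟩
  exact Submodule.subset_span ⟨i, (hb i).symm⟩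

/-- The split vectors are unitriangular in the chain, hence form a basis. -/
lemma IsLadder.splitVector_sub_mem (hL : IsLadder q κ ρ d A As v) (i : ℕ) :
    ladderSplitVector q κ d A v i - v i ∈ Submodule.span K (v '' Set.Iio i) := by
  have hmem : ∀ {k i : ℕ}, k < i → v k ∈ Submodule.span K (v '' Set.Iio i) := fun h =>
    Submodule.subset_span ⟨_, h, rfl⟩
  induction i with
  | zero => simp [ladderSplitVector]
  | succ i ih =>
    have hmono : Submodule.span K (v '' Set.Iio i) ≤ Submodule.span K (v '' Set.Iio (i + 1)) :=
      Submodule.span_mono (Set.image_mono (Set.Iio_subset_Iio (Nat.le_succ i)))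
    have hmap : Submodule.span K (v '' Set.Iio i) ≤
        (Submodule.span K (v '' Set.Iio (i + 1))).comap A := by
      rw [Submodule.span_le]
      rintro _ ⟨k, hk, rfl⟩
      have hk' : k < i := hk
      change A (v k) ∈ Submodule.span K (v '' Set.Iio (i + 1))
      rw [hL.apply]
      exact add_mem (hmem (by omega)) (Submodule.smul_mem _ _ (hmem (by omega)))
    have h1 : ladderSplitVector q κ d A v (i + 1) - v (i + 1) =
        A (ladderSplitVector q κ d A v i - v i) + ladderWeight q κ d i • v (i - 1) -
          ladderEigenvalue q κ d i • (ladderSplitVector q κ d A v i - v i) -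
          ladderEigenvalue q κ d i • v i := by
      rw [ladderSplitVector, map_sub, hL.apply]
      module
    rw [h1]
    exact sub_mem (sub_mem (add_mem (hmap ih) (Submodule.smul_mem _ _ (hmem (by omega))))
      (Submodule.smul_mem _ _ (hmono ih))) (Submodule.smul_mem _ _ (hmem (by omega)))

lemma IsLadder.repr_splitVector (hL : IsLadder q κ ρ d A As v) (b : Basis (Fin (d + 1)) K W)
    (hb : ∀ i : Fin (d + 1), b i = v i) {i : ℕ} {k : Fin (d + 1)} (hik : i ≤ k) :
    b.repr (ladderSplitVector q κ d A v i) k = if (k : ℕ) = i then 1 else 0 := by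
  have h1 : Submodule.span K (v '' Set.Iio i) ≤ LinearMap.ker (b.coord k) := by
    rw [Submodule.span_le]
    rintro _ ⟨j, hj, rfl⟩
    have hj' : j < i := hj
    change b.repr (v j) k = 0
    rw [repr_chain b hb (hL.eq_zero j), if_neg (by omega)]
  have h2 : b.repr (ladderSplitVector q κ d A v i - v i) k = 0 := h1 (hL.splitVector_sub_mem i)
  rw [map_sub, Finsupp.sub_apply, sub_eq_zero] at h2
  rw [h2, repr_chain b hb (hL.eq_zero i)]

lemma IsLadder.exists_splitBasis (hL : IsLadder q κ ρ d A As v) (b : Basis (Fin (d + 1)) K W)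
    (hb : ∀ i : Fin (d + 1), b i = v i) :
    ∃ u : Basis (Fin (d + 1)) K W, ∀ i : Fin (d + 1), u i = ladderSplitVector q κ d A v i := by
  have hdet : b.det (fun i : Fin (d + 1) => ladderSplitVector q κ d A v i) = 1 := by
    rw [Basis.det_apply, Matrix.det_of_isUpperTriangular]
    · refine Finset.prod_eq_one fun i _ => ?_
      rw [Basis.toMatrix_apply, hL.repr_splitVector b hb le_rfl, if_pos rfl]
    · intro k i hik
      have hik' : i < k := hik
      rw [Basis.toMatrix_apply, hL.repr_splitVector b hb hik'.le, if_neg]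
      exact fun h => hik'.ne' (Fin.ext h)
  obtain ⟨hli, hsp⟩ := (Basis.is_basis_iff_det b).2 (hdet ▸ isUnit_one)
  exact ⟨Basis.mk hli hsp.ge, fun i => by simp⟩

/-- The split coefficient vanishes at `d + 1`, so a nonzero vector here would be an eigenvector of
`As` for `ρ / q ^ (d + 1)`, which is not among its eigenvalues `ρ / q ^ k` with `k ≤ d`. -/
lemma IsLadder.splitVector_eq_zero (hL : IsLadder q κ ρ d A As v) (b : Basis (Fin (d + 1)) K W)
    (hb : ∀ i : Fin (d + 1), b i = v i) (hq : q ≠ 0) (hinj : Function.Injective (q ^ · : ℕ → K))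
    (hρ : ρ ≠ 0) : ladderSplitVector q κ d A v (d + 1) = 0 := by
  have hq1 : q ≠ 1 := fun h => by simpa using hinj (show q ^ 0 = q ^ 1 by simp [h])
  have h1 := hL.dual_splitVector (span_range_chain b hb) hq hq1 (d + 1)
  have h0 : ladderSplit q κ ρ d (d + 1) = 0 := by simp [ladderSplit]
  rw [h0, zero_smul, add_zero] at h1
  apply b.repr.injective
  ext k
  have h2 := repr_apply_of_eigenbasis (A := As) (θ := fun i => ρ / q ^ (i : ℕ)) b
    (fun i => by rw [hb, hL.dual_apply]) (ladderSplitVector q κ d A v (d + 1)) k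
  rw [h1, map_smul, Finsupp.smul_apply, smul_eq_mul] at h2
  rw [map_zero, Finsupp.zero_apply]
  by_contra hne
  have h3 := mul_right_cancel₀ hne h2
  have h4 : d + 1 = (k : ℕ) := hinj (div_pow_inj hρ h3)
  omega

theorem IsLadder.isSplitSequence (hL : IsLadder q κ ρ d A As v) (b : Basis (Fin (d + 1)) K W)
    (hb : ∀ i : Fin (d + 1), b i = v i) (hq : q ≠ 0) (hinj : Function.Injective (q ^ · : ℕ → K))
    (hρ : ρ ≠ 0) :
    IsSplitSequence A As (fun i : Fin (d + 1) => ladderEigenvalue q κ d i)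
      (fun i => ρ / q ^ (i : ℕ)) (ladderSplit q κ ρ d) := by
  have hq1 : q ≠ 1 := fun h => by simpa using hinj (show q ^ 0 = q ^ 1 by simp [h])
  obtain ⟨u, hu⟩ := hL.exists_splitBasis b hb
  have hzero := hL.splitVector_eq_zero b hb hq hinj hρ
  refine ⟨u, fun i j => ⟨?_, ?_⟩⟩
  · have hj : d < (j : ℕ) + 1 → ladderSplitVector q κ d A v (j + 1) = 0 := fun h => by
      rwa [show (j : ℕ) + 1 = d + 1 by omega]
    rw [LinearMap.toMatrix_apply, hu, ladderSplitVector_apply, map_add, map_smul,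
      Finsupp.add_apply, Finsupp.smul_apply, repr_chain u hu hj,
      repr_chain u hu (fun h => absurd j.2 (by omega))]
    simp only [Fin.ext_iff]
    split_ifs <;> first | omega | simp [*]
  · rw [LinearMap.toMatrix_apply, hu, hL.dual_splitVector (span_range_chain b hb) hq hq1, map_add,
      map_smul, map_smul, Finsupp.add_apply, Finsupp.smul_apply, Finsupp.smul_apply,
      repr_chain u hu (fun h => absurd j.2 (by omega)),
      repr_chain u hu (fun h => absurd j.2 (by omega))]
    simp only [Fin.ext_iff]
    rcases Nat.eq_zero_or_pos (j : ℕ) with hj | hj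
    · simp only [hj, ladderSplit_zero, smul_eq_mul, zero_mul, add_zero]
      by_cases hi : (i : ℕ) = 0 <;> simp [hi]
    · by_cases hi : (i : ℕ) = j
      · rw [if_pos hi, if_pos hi, if_neg (by omega), hi]
        simp
      · split_ifs <;> first | omega | simp

end LadderSystem

/-! ### Ladders are of dual `q`-Krawtchouk type. -/

section DualQKrawtchouk

variable {q κ ρ : K} {d : ℕ} {A As : End K W} {v : ℕ → W}

/-- Squaring would force `a = b`. This separates the eigenvalues of `A` and excludes `s * q ^ i =
1`, because `s` is minus a power of `q`. -/
lemma pow_ne_neg_pow [CharZero K] (hq : q ≠ 0) (hinj : Function.Injective (q ^ · : ℕ → K)) (a b : ℕ) :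
    q ^ a ≠ -q ^ b := by
  intro hab
  have h1 : a * 2 = b * 2 := hinj (show q ^ (a * 2) = q ^ (b * 2) by
    rw [pow_mul, hab, neg_sq, pow_mul])
  have h2 : a = b := by omega
  subst h2
  exact self_ne_neg.2 (pow_ne_zero a hq) hab

lemma ladderEigenvalue_injective [CharZero K] (hq : q ≠ 0) (hinj : Function.Injective (q ^ · : ℕ → K))
    (hκ : κ ≠ 0) : Function.Injective (ladderEigenvalue q κ d) := by
  intro i j hij
  have hq1 : q - 1 ≠ 0 :=
    sub_ne_zero.2 fun h => by simpa using hinj (show q ^ 0 = q ^ 1 by simp [h])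
  have h1 : κ * ((q ^ j - q ^ i) * (q ^ d + q ^ (i + j))) = 0 := by
    simp only [ladderEigenvalue] at hij
    field_simp at hij
    rw [pow_add]
    linear_combination κ * hij
  have h2 : q ^ d + q ^ (i + j) ≠ 0 := fun h =>
    pow_ne_neg_pow hq hinj d (i + j) (eq_neg_of_add_eq_zero_left h)
  have h3 := (mul_eq_zero.1 ((mul_eq_zero.1 h1).resolve_left hκ)).resolve_right h2
  exact (hinj (sub_eq_zero.1 h3)).symm

lemma ladderSplit_ne_zero (hq : q ≠ 0) (hinj : Function.Injective (q ^ · : ℕ → K))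
    (hκ : κ ≠ 0) (hρ : ρ ≠ 0) {i : ℕ} (h1 : 1 ≤ i) (hd : i ≤ d) : ladderSplit q κ ρ d i ≠ 0 := by
  have hq1 : q - 1 ≠ 0 :=
    sub_ne_zero.2 fun h => by simpa using hinj (show q ^ 0 = q ^ 1 by simp [h])
  have h2 : 1 - q ^ i ≠ 0 := sub_ne_zero.2 fun h => by
    have := hinj (show q ^ 0 = q ^ i by simpa using h)
    omega
  have h3 : q ^ (d + 1) - q ^ i ≠ 0 := sub_ne_zero.2 fun h => by
    have := hinj h
    omega
  rw [ladderSplit]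
  positivity

lemma ladderWeight_ne_zero (hq : q ≠ 0) (hinj : Function.Injective (q ^ · : ℕ → K))
    (hκ : κ ≠ 0) {i : ℕ} (h1 : 1 ≤ i) (hd : i ≤ d) : ladderWeight q κ d i ≠ 0 := by
  have hq1 : q - 1 ≠ 0 :=
    sub_ne_zero.2 fun h => by simpa using hinj (show q ^ 0 = q ^ 1 by simp [h])
  have h2 : q ^ i - 1 ≠ 0 := sub_ne_zero.2 fun h => by
    have := hinj (show q ^ i = q ^ 0 by simpa using h)
    omega
  have h3 : q ^ (d + 1) - q ^ i ≠ 0 := sub_ne_zero.2 fun h => by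
    have := hinj h
    omega
  rw [ladderWeight]
  positivity

lemma ladderEigenvalue_rev (hq : q ≠ 0) (κ : K) (i : Fin (d + 1)) :
    ladderEigenvalue q κ d i.rev = ladderEigenvalue q (-κ) d i := by
  have h1 : q ^ d = q ^ (i.rev : ℕ) * q ^ (i : ℕ) := by
    rw [← pow_add, Fin.val_rev]
    congr 1
    omega
  simp only [ladderEigenvalue, h1]
  field_simp
  ring

lemma IsLadder.repr_apply (hL : IsLadder q κ ρ d A As v) (b : Basis (Fin (d + 1)) K W)
    (hb : ∀ i : Fin (d + 1), b i = v i) (i j : Fin (d + 1)) :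
    b.repr (A (b j)) i = if (i : ℕ) = j + 1 then 1 else if (j : ℕ) = i + 1 then
      ladderWeight q κ d j else 0 := by
  rw [hb, hL.apply, map_add, map_smul, Finsupp.add_apply, Finsupp.smul_apply,
    repr_chain b hb (hL.eq_zero _), repr_chain b hb (hL.eq_zero _)]
  rcases Nat.eq_zero_or_pos (j : ℕ) with hj | hj
  · simp [hj, ladderWeight]
  · split_ifs <;> first | omega | simp

/-- A ladder is a bipartite Leonard system of dual `q`-Krawtchouk type. -/
theorem IsLadder.exists_leonardSystem [CharZero K] (hL : IsLadder q κ ρ d A As v)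
    (b : Basis (Fin (d + 1)) K W) (hb : ∀ i : Fin (d + 1), b i = v i) (hq : q ≠ 0)
    (hinj : Function.Injective (q ^ · : ℕ → K)) (hκ : κ ≠ 0) (hρ : ρ ≠ 0) :
    ∃ Φ : LeonardSystem K W d, Φ.A = A ∧ Φ.As = As ∧ IsMultiplicityFree A ∧
      IsLeonardPair A As ∧ Φ.IsBipartite ∧
      IsEigenvalueSequence A Φ.E (fun i => ladderEigenvalue q κ d i) ∧
      IsEigenvalueSequence As Φ.Es (fun i => ρ / q ^ (i : ℕ)) ∧
      Φ.IsDualQKrawtchouk q (κ * q ^ d / (q - 1)) ρ (-q ^ (-(d : ℤ) - 1))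
        (κ * (q ^ d - 1) / (q - 1)) ρ := by
  have hq1 : q - 1 ≠ 0 :=
    sub_ne_zero.2 fun h => by simpa using hinj (show q ^ 0 = q ^ 1 by simp [h])
  have hθ : Function.Injective fun i : Fin (d + 1) => ladderEigenvalue q κ d i :=
    (ladderEigenvalue_injective hq hinj hκ).comp Fin.val_injective
  have hθs : Function.Injective fun i : Fin (d + 1) => ρ / q ^ (i : ℕ) := by
    intro i j hij
    exact Fin.ext (hinj (div_pow_inj hρ hij))
  have hbs : ∀ i, As (b i) = (ρ / q ^ (i : ℕ)) • b i := fun i => by rw [hb, hL.dual_apply]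
  have htri : IsIrreducibleTridiagonal (LinearMap.toMatrix b b A) := by
    intro i j
    rw [LinearMap.toMatrix_apply, hL.repr_apply b hb]
    have hi := i.2
    have hj := j.2
    refine ⟨fun h => by rw [if_neg (by omega), if_neg (by omega)], fun h => ?_⟩
    rcases h with h | h
    · rw [if_neg (by omega), if_pos h.symm]
      exact ladderWeight_ne_zero hq hinj hκ (by omega) (by omega)
    · rw [if_pos h.symm]
      exact one_ne_zero
  have hs := hL.isSplitSequence b hb hq hinj hρ
  have hs' := hL.neg.isSplitSequence b hb hq hinj hρ
  simp only [← ladderEigenvalue_rev hq κ] at hs'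
  obtain ⟨Φ, hΦA, hΦAs, hΦ, hmf, hLP⟩ := exists_leonardSystem_of_isSplitSequence b hbs hθs htri
    hs hs' hθ (fun i h1 h2 => ladderSplit_ne_zero hq hinj hκ hρ h1 h2)
    (fun i h1 h2 => ladderSplit_ne_zero hq hinj (neg_ne_zero.2 hκ) hρ h1 h2)
  refine ⟨Φ, hΦA, hΦAs, hmf, hLP, fun i => ?_, hΦA ▸ hΦ.eigenvalue, hΦAs ▸ hΦ.dualEigenvalue,
    ⟨hq, ?_, hρ, ?_, fun i h1 _ h => ?_, fun i _ _ h => ?_, ?_⟩⟩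
  -- The trace of `E*_i A` is a diagonal entry of `A` in the chain basis, where `A` only moves to
  -- neighbours.
  · rw [LinearMap.trace_eq_matrix_trace K b, Matrix.trace]
    refine Finset.sum_eq_zero fun k _ => ?_
    rw [Matrix.diag_apply, LinearMap.toMatrix_apply, Module.End.mul_apply,
      hΦ.dualEigenvalue.2.2 i, hΦA, hΦAs,
      primitiveIdempotent_apply_of_eigenbasis b hbs hθs, map_smul, Finsupp.smul_apply,
      hL.repr_apply b hb, Basis.repr_self, Finsupp.single_apply]
    by_cases hik : i = k
    · subst hik; simp
    · simp [hik]
  · exact div_ne_zero (mul_ne_zero hκ (pow_ne_zero d hq)) hq1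
  · exact neg_ne_zero.2 (zpow_ne_zero _ hq)
  · have := hinj (show q ^ i = q ^ 0 by simpa using h)
    omega
  · have h2 : q ^ (-(d : ℤ) - 1) * q ^ (d + 1) = 1 := by
      rw [← zpow_natCast, ← zpow_add₀ hq]
      simp
    refine pow_ne_neg_pow hq hinj i (d + 1) ?_
    linear_combination (-q ^ (d + 1)) * h - q ^ i * h2
  · have hzd : q ^ (-(d : ℤ) - 1) = (q ^ d * q)⁻¹ := by
      rw [← pow_succ, ← zpow_natCast, ← zpow_neg]
      congr 1
      push_cast
      ring
    have hz1 : ∀ i : ℕ, q ^ (1 - 2 * (i : ℤ)) = q / (q ^ i) ^ 2 := fun i => by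
      rw [zpow_sub₀ hq, zpow_one, mul_comm, zpow_mul, zpow_natCast]
      norm_cast
    have hz2 : ∀ i : ℕ, q ^ ((i : ℤ) - d - 1) = q ^ i / (q ^ d * q) := fun i => by
      rw [sub_sub, zpow_sub₀ hq, zpow_natCast, zpow_add₀ hq, zpow_natCast, zpow_one]
    have hz3 : ∀ i : ℕ, q ^ ((d : ℤ) + 2 - 2 * i) = q ^ d * q ^ 2 / (q ^ i) ^ 2 := fun i => by
      rw [zpow_sub₀ hq, zpow_add₀ hq, zpow_natCast, mul_comm (2 : ℤ), zpow_mul, zpow_natCast]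
      norm_cast
    convert hΦ using 1
    · funext i
      rw [hzd, ladderEigenvalue]
      field_simp
      ring
    · funext i
      field_simp
      ring
    · funext i
      rw [hz1, hz2, ladderSplit]
      field_simp
      ring
    · funext i
      rw [hz2, hz3, hzd, ladderSplit]
      field_simp
      ring

end DualQKrawtchouk

end LeonardTheory

/-! ### The levels and the action of the generators on them. -/

namespace AttenuatedSpace

open Matrix

variable {F H : Type*} [Field F] [AddCommGroup H] [Module F H] {h : Submodule F H}

variable (h) in
/-- The functions supported on the vertices of dimension `i`. -/
def level (i : ℕ) : Submodule ℂ (Vertex h → ℂ) where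
  carrier := {f | ∀ y, y.dim ≠ i → f y = 0}
  add_mem' hf hg y hy := by simp [hf y hy, hg y hy]
  zero_mem' _ _ := rfl
  smul_mem' c f hf y hy := by simp [hf y hy]

/-- The weight that makes the `q`-adjacency matrix symmetric. -/
def symmWeight (y : Vertex h) : ℝ := √(Nat.card F : ℝ) ^ y.dim.choose 2

lemma symmWeight_ne_zero [Finite F] (y : Vertex h) : (symmWeight y : ℂ) ≠ 0 := by
  have : 1 < Nat.card F := Finite.one_lt_card
  have h1 : (0 : ℝ) < Nat.card F := by exact_mod_cast (by omega : 0 < Nat.card F)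
  exact_mod_cast (pow_pos (Real.sqrt_pos.2 h1) _).ne'

variable [FiniteDimensional F H]

lemma Vertex.dim_add_le (y : Vertex h) : y.dim + Module.finrank F h ≤ Module.finrank F H := by
  have h1 := Submodule.finrank_sup_add_finrank_inf_eq y.space h
  rw [y.space_inf, finrank_bot] at h1
  have h2 := Submodule.finrank_le (y.space ⊔ h)
  rw [y.dim_eq]
  omega

lemma eq_zero_of_mem_level {i : ℕ} (hi : Module.finrank F H < i + Module.finrank F h)
    {f : Vertex h → ℂ} (hf : f ∈ level h i) : f = 0 := by
  ext y
  have := y.dim_add_le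
  exact hf y (by omega)

lemma symmWeight_of_covBy {y z : Vertex h} (hyz : y ⋖ z) :
    symmWeight z = symmWeight y * √(Nat.card F : ℝ) ^ y.dim := by
  rw [symmWeight, symmWeight, Vertex.dim_of_covBy hyz, Nat.choose_succ_succ, Nat.choose_one_right,
    pow_add, mul_comm]

variable [Finite F]

lemma card_pow_injective : Function.Injective ((Nat.card F : ℂ) ^ · : ℕ → ℂ) := by
  intro i j hij
  have : Nat.card F ^ i = Nat.card F ^ j := by
    simp only at hij
    exact_mod_cast hij
  exact Nat.pow_right_injective Finite.one_lt_card this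

lemma card_ne_zero : (Nat.card F : ℂ) ≠ 0 := by
  have : 1 < Nat.card F := Finite.one_lt_card
  exact_mod_cast (by omega : Nat.card F ≠ 0)

lemma card_sub_one_ne_zero : (Nat.card F : ℂ) - 1 ≠ 0 := by
  have : 1 < Nat.card F := Finite.one_lt_card
  exact sub_ne_zero.2 (by exact_mod_cast this.ne')

lemma dualAdj_mulVec {i : ℕ} {f : Vertex h → ℂ} (hf : f ∈ level h i) :
    dualAdj h *ᵥ f = ((Nat.card F : ℂ) ^ i)⁻¹ • f := by
  ext y
  rw [dualAdj, mulVec_diagonal, Pi.smul_apply, smul_eq_mul]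
  by_cases hy : y.dim = i
  · rw [hy]
  · rw [hf y hy, mul_zero, mul_zero]

lemma dualIdem_mulVec_mem (i : ℕ) (f : Vertex h → ℂ) : dualIdem h i *ᵥ f ∈ level h i := by
  intro y hy
  rw [dualIdem, mulVec_diagonal, if_neg hy, zero_mul]

lemma dualIdem_mulVec {i : ℕ} (j : ℕ) {f : Vertex h → ℂ} (hf : f ∈ level h i) :
    dualIdem h j *ᵥ f = if j = i then f else 0 := by
  ext y
  rw [dualIdem, mulVec_diagonal]
  by_cases hy : y.dim = i
  · subst hy
    by_cases hj : j = y.dim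
    · simp [hj]
    · simp [hj, Ne.symm hj]
  · rw [hf y hy, mul_zero]
    split_ifs
    · exact (hf y hy).symm
    · rfl

lemma raising_mulVec_mem {i : ℕ} {f : Vertex h → ℂ} (hf : f ∈ level h i) :
    raising h *ᵥ f ∈ level h (i + 1) := by
  classical
  intro y hy
  refine Finset.sum_eq_zero fun z _ => ?_
  by_cases hz : z ⋖ y
  · have := Vertex.dim_of_covBy hz
    rw [hf z (by omega), mul_zero]
  · simp [raising, hz]

lemma lowering_mulVec_mem {i : ℕ} {f : Vertex h → ℂ} (hf : f ∈ level h (i + 1)) :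
    lowering h *ᵥ f ∈ level h i := by
  classical
  intro y hy
  refine Finset.sum_eq_zero fun z _ => ?_
  by_cases hz : y ⋖ z
  · have := Vertex.dim_of_covBy hz
    rw [hf z (by omega), mul_zero]
  · simp [lowering, hz]

lemma lowering_mulVec_zero {f : Vertex h → ℂ} (hf : f ∈ level h 0) :
    lowering h *ᵥ f = 0 := by
  classical
  ext y
  refine Finset.sum_eq_zero fun z _ => ?_
  by_cases hz : y ⋖ z
  · have := Vertex.dim_of_covBy hz
    rw [hf z (by omega), mul_zero]
  · simp [lowering, hz]

lemma lowering_raising_mulVec {i : ℕ} {f : Vertex h → ℂ} (hf : f ∈ level h i) :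
    lowering h *ᵥ (raising h *ᵥ f) + outsideCount h *ᵥ f = raising h *ᵥ (lowering h *ᵥ f) +
      (((Nat.card F : ℂ) ^ (Module.finrank F H - i) - 1) / ((Nat.card F : ℂ) - 1) -
        ((Nat.card F : ℂ) ^ i - 1) / ((Nat.card F : ℂ) - 1)) • f := by
  have h1 := congrArg (· *ᵥ f) (lowering_mul_raising_add_outsideCount (h := h))
  simp only [add_mulVec, ← mulVec_mulVec] at h1
  rw [h1]
  congr 1
  ext y
  rw [mulVec_diagonal, Pi.smul_apply, smul_eq_mul]
  by_cases hy : y.dim = i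
  · rw [hy]
  · rw [hf y hy, mul_zero, mul_zero]

lemma outsideCount_mulVec {i : ℕ} {f : Vertex h → ℂ} (hf : f ∈ level h i) :
    outsideCount h *ᵥ f = raising h *ᵥ (lowering h *ᵥ f) +
      (((Nat.card F : ℂ) ^ (Module.finrank F H - i) - 1) / ((Nat.card F : ℂ) - 1) -
        ((Nat.card F : ℂ) ^ i - 1) / ((Nat.card F : ℂ) - 1)) • f -
      lowering h *ᵥ (raising h *ᵥ f) := by
  rw [← lowering_raising_mulVec hf, add_sub_cancel_left]

lemma outsideCount_mulVec_mem {i : ℕ} {f : Vertex h → ℂ} (hf : f ∈ level h i) :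
    outsideCount h *ᵥ f ∈ level h i := by
  rw [outsideCount_mulVec hf]
  refine sub_mem (add_mem ?_ (Submodule.smul_mem _ _ hf))
    (lowering_mulVec_mem (raising_mulVec_mem hf))
  rcases i with _ | i
  · rw [lowering_mulVec_zero hf, mulVec_zero]
    exact zero_mem _
  · exact raising_mulVec_mem (lowering_mulVec_mem hf)

lemma outsideCount_raising_mulVec (f : Vertex h → ℂ) :
    outsideCount h *ᵥ (raising h *ᵥ f) =
      (Nat.card F : ℂ) • (raising h *ᵥ (outsideCount h *ᵥ f)) := by
  rw [mulVec_mulVec, outsideCount_mul_raising, smul_mulVec, mulVec_mulVec]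

lemma qAdj_eq : qAdj h = raising h +
    Matrix.diagonal (fun y : Vertex h => (Nat.card F : ℂ) ^ y.dim) * lowering h := by
  classical
  ext y z
  rw [Matrix.add_apply, diagonal_mul]
  simp only [qAdj, raising, lowering, of_apply]
  by_cases h1 : z ⋖ y
  · have h2 : ¬ y ⋖ z := fun h2 => h1.lt.asymm h2.lt
    simp [h1, h2]
  · simp [h1]

lemma qAdj_mulVec {i : ℕ} {f : Vertex h → ℂ} (hf : f ∈ level h i) :
    qAdj h *ᵥ f = raising h *ᵥ f + ((Nat.card F : ℂ) ^ i / Nat.card F) • (lowering h *ᵥ f) := by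
  rw [qAdj_eq, add_mulVec, ← mulVec_mulVec]
  congr 1
  rcases i with _ | i
  · rw [lowering_mulVec_zero hf, mulVec_zero, smul_zero]
  · rw [pow_succ, mul_div_cancel_right₀ _ card_ne_zero]
    ext y
    rw [mulVec_diagonal, Pi.smul_apply, smul_eq_mul]
    by_cases hy : y.dim = i
    · rw [hy]
    · rw [lowering_mulVec_mem hf y hy, mul_zero, mul_zero]

lemma sum_dualIdem_mulVec {N : ℕ} (hN : Module.finrank F H ≤ N + Module.finrank F h)
    (f : Vertex h → ℂ) : ∑ i ∈ Finset.range (N + 1), dualIdem h i *ᵥ f = f := by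
  ext y
  rw [Finset.sum_apply, Finset.sum_eq_single y.dim]
  · simp [dualIdem, mulVec_diagonal]
  · intro i _ hi
    simp [dualIdem, mulVec_diagonal, hi.symm]
  · intro hy
    have := y.dim_add_le
    simp only [Finset.mem_range] at hy
    omega

/-- The values of `A*` on different levels are distinct, so Lagrange interpolation writes `E*_i` as
a polynomial in `A*`. -/
lemma dualIdem_mem_subconstituentAlgebra (i : ℕ) : dualIdem h i ∈ subconstituentAlgebra h := by
  set s := Finset.range (Module.finrank F H + 1)
  set x : ℕ → ℂ := fun j => ((Nat.card F : ℂ) ^ j)⁻¹ with hx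
  set p := Lagrange.interpolate s x (fun j => if j = i then 1 else 0)
  have hinj : Set.InjOn x s := fun j _ k _ hjk => card_pow_injective (inv_injective hjk)
  have hp : dualIdem h i = Polynomial.aeval (dualAdj h) p := by
    have h1 : dualAdj h = diagonalAlgHom ℂ (fun y : Vertex h => x y.dim) := rfl
    rw [h1, Polynomial.aeval_algHom_apply]
    change _ = Matrix.diagonal _
    rw [dualIdem]
    congr 1
    funext y
    rw [Polynomial.aeval_pi_apply]
    beta_reduce
    rw [Polynomial.coe_aeval_eq_eval, Lagrange.eval_interpolate_at_node _ hinj]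
    have := y.dim_add_le
    exact Finset.mem_range.2 (by omega)
  rw [hp]
  exact Algebra.adjoin_mono (by simp) (Polynomial.aeval_mem_adjoin_singleton ℂ (dualAdj h))

/-! ### Diagonalizability of the `q`-adjacency matrix. -/

section Diagonalizable

/-- The weights of a vertex of dimension `i` and of its cover differ by the factor `√q ^ i`, so
conjugation turns the two entries `1` and `q ^ i` into the same number `√q ^ i`. -/
lemma isHermitian_symmetrized : (Matrix.of fun y z : Vertex h =>
    (symmWeight y : ℂ) * qAdj h y z / symmWeight z).IsHermitian := by
  classical
  have key : ∀ y z : Vertex h, y ⋖ z →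
      (symmWeight z : ℂ) * qAdj h z y / symmWeight y =
        ((√(Nat.card F : ℝ) ^ y.dim : ℝ) : ℂ) ∧
      (symmWeight y : ℂ) * qAdj h y z / symmWeight z =
        ((√(Nat.card F : ℝ) ^ y.dim : ℝ) : ℂ) := by
    intro y z hyz
    have h0 := symmWeight_ne_zero y
    have h0' := symmWeight_ne_zero z
    have h1 : qAdj h z y = 1 := by simp [qAdj, hyz]
    have h2 : qAdj h y z = ((√(Nat.card F : ℝ) ^ y.dim : ℝ) : ℂ) ^ 2 := by
      have : ¬ z ⋖ y := fun h' => hyz.lt.asymm h'.lt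
      simp only [qAdj, of_apply, if_neg this, if_pos hyz]
      rw [← Complex.ofReal_pow, ← pow_mul, mul_comm, pow_mul, Real.sq_sqrt (Nat.cast_nonneg _)]
      push_cast
      rfl
    have h3 : (symmWeight z : ℂ) = symmWeight y * ((√(Nat.card F : ℝ) ^ y.dim : ℝ) : ℂ) := by
      rw [symmWeight_of_covBy hyz, Complex.ofReal_mul]
    constructor
    · rw [h1, h3]
      field_simp
    · rw [h2, div_eq_iff h0', h3]
      ring
  ext y z
  rw [conjTranspose_apply, of_apply, of_apply]
  by_cases h1 : y ⋖ z
  · rw [(key y z h1).1, (key y z h1).2]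
    exact Complex.conj_ofReal _
  · by_cases h2 : z ⋖ y
    · rw [(key z y h2).1, (key z y h2).2]
      exact Complex.conj_ofReal _
    · simp [qAdj, h1, h2]

/-- Needed on the whole standard module: otherwise `primitiveIdempotent` could take its default
value 0 there. -/
lemma iSup_eigenspace_qAdj : (⨆ μ : ℂ, Module.End.eigenspace (toLin' (qAdj h)) μ) = ⊤ := by
  have hS := isHermitian_symmetrized (h := h)
  set S := Matrix.of fun y z : Vertex h => (symmWeight y : ℂ) * qAdj h y z / symmWeight z with hSdef
  set D : Matrix (Vertex h) (Vertex h) ℂ := Matrix.diagonal fun y => (symmWeight y : ℂ)⁻¹ with hD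
  have hcomm : qAdj h * D = D * S := by
    ext y z
    have h0 := symmWeight_ne_zero y
    rw [hD, mul_diagonal, diagonal_mul, hSdef, of_apply]
    field_simp
  set P := ⨆ μ : ℂ, Module.End.eigenspace (toLin' (qAdj h)) μ with hP
  have hmem : ∀ x : EuclideanSpace ℂ (Vertex h), D *ᵥ x.ofLp ∈ P := by
    intro x
    rw [← hS.eigenvectorBasis.sum_repr x]
    simp only [WithLp.ofLp_sum, WithLp.ofLp_smul, mulVec_sum, mulVec_smul]
    refine Submodule.sum_mem _ fun j _ => Submodule.smul_mem _ _ ?_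
    refine Submodule.mem_iSup_of_mem ((hS.eigenvalues j : ℝ) : ℂ) ?_
    rw [Module.End.mem_eigenspace_iff, toLin'_apply, mulVec_mulVec, hcomm, ← mulVec_mulVec,
      hS.mulVec_eigenvectorBasis]
    rw [mulVec_smul]
    rfl
  rw [eq_top_iff]
  intro f _
  have h1 := hmem (WithLp.toLp 2 fun y => (symmWeight y : ℂ) * f y)
  convert h1 using 1
  ext y
  rw [hD, mulVec_diagonal]
  have h0 := symmWeight_ne_zero y
  field_simp

end Diagonalizable

end AttenuatedSpace

/-! ### Primitive idempotents on invariant subspaces. -/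

section LeonardTheory

variable {K V : Type*} [Field K] [AddCommGroup V] [Module K V]

/-- Primitive idempotents are compatible with restriction to an invariant subspace. -/
lemma primitiveIdempotent_restrict {A : Module.End K V} (hA : (⨆ μ : K, A.eigenspace μ) = ⊤)
    {W : Submodule K V} {B : Module.End K W} (hB : ∀ w : W, (B w : V) = A w)
    (hBtop : (⨆ μ : K, B.eigenspace μ) = ⊤) (μ : K) (w : W) :
    (primitiveIdempotent B μ w : V) = primitiveIdempotent A μ w := by
  have hw : w ∈ ⨆ μ : K, B.eigenspace μ := hBtop ▸ Submodule.mem_top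
  induction hw using Submodule.iSup_induction' with
  | mem ν x hx =>
    rw [Module.End.mem_eigenspace_iff] at hx
    have hx' : A x = ν • (x : V) := by rw [← hB, hx, Submodule.coe_smul]
    by_cases h : μ = ν
    · rw [(primitiveIdempotent_apply_of_mem hA μ ν hx').1 h,
        (primitiveIdempotent_apply_of_mem hBtop μ ν hx).1 h]
    · rw [(primitiveIdempotent_apply_of_mem hA μ ν hx').2 h,
        (primitiveIdempotent_apply_of_mem hBtop μ ν hx).2 h, Submodule.coe_zero]
  | zero => simp
  | add x y _ _ hx hy => simp only [map_add, Submodule.coe_add, hx, hy]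

end LeonardTheory

namespace AttenuatedSpace

open Matrix

variable {F H : Type*} [Field F] [AddCommGroup H] [Module F H] {h : Submodule F H}
  [FiniteDimensional F H] [Finite F]

/-! ### The chain generated by raising a bottom vector. -/

section Chain

/-- The vectors `R ^ k f`. -/
def raisingChain (f : Vertex h → ℂ) (k : ℕ) : Vertex h → ℂ := (raising h *ᵥ ·)^[k] f

lemma raisingChain_succ (f : Vertex h → ℂ) (k : ℕ) :
    raisingChain f (k + 1) = raising h *ᵥ raisingChain f k := by
  rw [raisingChain, Function.iterate_succ_apply']
  rfl

/-- The scalar by which lowering acts along a chain. -/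
def chainWeight (q ν : ℂ) (n r k : ℕ) : ℂ :=
  (q ^ k - 1) * (q ^ (n + 1) / q ^ (r + k) - ν) / (q - 1) ^ 2

lemma raisingChain_mem_level {r : ℕ} {f : Vertex h → ℂ} (hf : f ∈ level h r) (k : ℕ) :
    raisingChain f k ∈ level h (r + k) := by
  induction k with
  | zero => exact hf
  | succ k ih =>
    rw [raisingChain_succ]
    exact raising_mulVec_mem ih

lemma outsideCount_raisingChain {f : Vertex h → ℂ} {μ : ℂ}
    (hC : outsideCount h *ᵥ f = μ • f) (k : ℕ) :
    outsideCount h *ᵥ raisingChain f k = ((Nat.card F : ℂ) ^ k * μ) • raisingChain f k := by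
  induction k with
  | zero => simpa [raisingChain] using hC
  | succ k ih =>
    rw [raisingChain_succ, outsideCount_raising_mulVec, ih, mulVec_smul, smul_smul, pow_succ]
    congr 1
    ring

/-- Each step moves `L` past one `R`, at the cost of a scalar and of `q ^ k * μ` from `C`. The
scalars add up as geometric sums, and `r` and `μ` enter the factored result through `ν = q ^ r + (q
- 1) * μ`. -/
lemma lowering_raisingChain {r : ℕ} {f : Vertex h → ℂ} {μ : ℂ} (hf : f ∈ level h r)
    (hL : lowering h *ᵥ f = 0) (hC : outsideCount h *ᵥ f = μ • f) (k : ℕ) :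
    lowering h *ᵥ raisingChain f (k + 1) =
      chainWeight (Nat.card F : ℂ) ((Nat.card F : ℂ) ^ r + ((Nat.card F : ℂ) - 1) * μ)
        (Module.finrank F H) r (k + 1) • raisingChain f k := by
  have hq := card_ne_zero (F := F)
  have hq1 := card_sub_one_ne_zero (F := F)
  set q : ℂ := (Nat.card F : ℂ) with hqdef
  have hstep : ∀ k, lowering h *ᵥ raisingChain f (k + 1) =
      raising h *ᵥ (lowering h *ᵥ raisingChain f k) +
        ((q ^ Module.finrank F H / q ^ (r + k) - q ^ (r + k)) / (q - 1) - q ^ k * μ) •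
          raisingChain f k := by
    intro k
    have h1 := lowering_raising_mulVec (raisingChain_mem_level hf k)
    rw [outsideCount_raisingChain hC, ← raisingChain_succ, ← eq_sub_iff_add_eq] at h1
    rw [h1, add_sub_assoc, ← sub_smul]
    -- Beyond this range the subtraction in the exponent truncates, but the level is zero there.
    by_cases hk : r + k ≤ Module.finrank F H
    · congr 2
      rw [← hqdef, pow_sub₀ _ hq hk]
      ring
    · have h0 : raisingChain f k = 0 :=
        eq_zero_of_mem_level (by omega) (raisingChain_mem_level hf k)
      rw [h0, smul_zero, smul_zero]
  induction k with
  | zero =>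
    rw [hstep]
    have h0 : raisingChain f 0 = f := rfl
    rw [h0, hL, mulVec_zero, zero_add]
    congr 1
    simp only [chainWeight]
    field_simp
    ring
  | succ k ih =>
    rw [hstep, ih, mulVec_smul, ← raisingChain_succ, ← add_smul]
    congr 1
    simp only [chainWeight]
    field_simp
    ring

end Chain

/-! ### Irreducible modules are chains. -/

section Irreducible

lemma IsTModule.of_generators {U : Submodule ℂ (Vertex h → ℂ)}
    (hR : ∀ w ∈ U, raising h *ᵥ w ∈ U) (hL : ∀ w ∈ U, lowering h *ᵥ w ∈ U)
    (hA : ∀ w ∈ U, dualAdj h *ᵥ w ∈ U) : IsTModule U := by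
  intro B hB
  induction hB using Algebra.adjoin_induction with
  | mem x hx =>
    rcases hx with rfl | rfl | rfl
    · exact hR
    · exact hL
    · exact hA
  | algebraMap c =>
    intro w hw
    rw [Algebra.algebraMap_eq_smul_one, smul_mulVec, one_mulVec]
    exact U.smul_mem c hw
  | add x y _ _ hx hy =>
    intro w hw
    rw [add_mulVec]
    exact add_mem (hx w hw) (hy w hw)
  | mul x y _ _ hx hy =>
    intro w hw
    rw [← mulVec_mulVec]
    exact hx _ (hy w hw)

variable {W : Submodule ℂ (Vertex h → ℂ)}

lemma IsTModule.raising_mem (hW : IsTModule W) {w : Vertex h → ℂ} (hw : w ∈ W) :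
    raising h *ᵥ w ∈ W := hW _ (Algebra.subset_adjoin (by simp)) w hw

lemma IsTModule.lowering_mem (hW : IsTModule W) {w : Vertex h → ℂ} (hw : w ∈ W) :
    lowering h *ᵥ w ∈ W := hW _ (Algebra.subset_adjoin (by simp)) w hw

lemma IsTModule.dualAdj_mem (hW : IsTModule W) {w : Vertex h → ℂ} (hw : w ∈ W) :
    dualAdj h *ᵥ w ∈ W := hW _ (Algebra.subset_adjoin (by simp)) w hw

lemma IsTModule.dualIdem_mem (hW : IsTModule W) (i : ℕ) {w : Vertex h → ℂ} (hw : w ∈ W) :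
    dualIdem h i *ᵥ w ∈ W := hW _ (dualIdem_mem_subconstituentAlgebra i) w hw

lemma IsTModule.outsideCount_mem (hW : IsTModule W) {i : ℕ} {w : Vertex h → ℂ} (hw : w ∈ W)
    (hi : w ∈ level h i) : outsideCount h *ᵥ w ∈ W := by
  rw [outsideCount_mulVec hi]
  exact sub_mem (add_mem (hW.raising_mem (hW.lowering_mem hw)) (W.smul_mem _ hw))
    (hW.lowering_mem (hW.raising_mem hw))

lemma IsTModule.mem_support_iff (hW : IsTModule W) {N i : ℕ} :
    i ∈ support N W ↔ i ≤ N ∧ W ⊓ level h i ≠ ⊥ := by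
  refine and_congr_right fun _ => not_congr ?_
  rw [eq_bot_iff, eq_bot_iff]
  constructor
  · rintro hm w ⟨hw, hwi⟩
    refine hm ⟨w, hw, ?_⟩
    rw [toLin'_apply, dualIdem_mulVec i hwi, if_pos rfl]
  · rintro hm _ ⟨w, hw, rfl⟩
    rw [toLin'_apply]
    exact hm ⟨hW.dualIdem_mem i hw, dualIdem_mulVec_mem i w⟩

lemma IsTModule.support_nonempty (hW : IsTModule W) (hbot : W ≠ ⊥) {N : ℕ}
    (hN : Module.finrank F H ≤ N + Module.finrank F h) : (support N W).Nonempty := by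
  by_contra hne
  rw [Set.not_nonempty_iff_eq_empty] at hne
  refine hbot ((Submodule.eq_bot_iff W).2 fun w hw => ?_)
  rw [← sum_dualIdem_mulVec hN w]
  refine Finset.sum_eq_zero fun i hi => ?_
  have h1 : i ∉ support N W := by simp [hne]
  rw [hW.mem_support_iff, not_and, not_not] at h1
  have h2 := h1 (by simpa [Nat.lt_succ_iff] using hi)
  exact (Submodule.eq_bot_iff _).1 h2 _ ⟨hW.dualIdem_mem i hw, dualIdem_mulVec_mem i w⟩

/-- The bottom layer of a nonzero `T`-module contains an eigenvector for `outsideCount`. -/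
lemma IsTModule.exists_bottom_vector (hW : IsTModule W) (hbot : W ≠ ⊥) {N : ℕ}
    (hN : Module.finrank F H ≤ N + Module.finrank F h) :
    ∃ f ∈ W, f ≠ 0 ∧ f ∈ level h (endpoint N W) ∧ lowering h *ᵥ f = 0 ∧
      ∃ μ : ℂ, outsideCount h *ᵥ f = μ • f := by
  set r := endpoint N W with hr
  have hmem : r ∈ support N W := Nat.sInf_mem (hW.support_nonempty hbot hN)
  obtain ⟨hrN, hne⟩ := hW.mem_support_iff.1 hmem
  set U := W ⊓ level h r with hU
  have hCU : ∀ w ∈ U, toLin' (outsideCount h) w ∈ U := fun w hw =>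
    ⟨hW.outsideCount_mem hw.1 hw.2, outsideCount_mulVec_mem hw.2⟩
  have : Nontrivial U := Submodule.nontrivial_iff_ne_bot.2 hne
  obtain ⟨μ, hμ⟩ := Module.End.exists_eigenvalue ((toLin' (outsideCount h)).restrict hCU)
  obtain ⟨f, hf⟩ := hμ.exists_hasEigenvector
  refine ⟨f, f.2.1, fun h0 => hf.2 (Subtype.ext h0), f.2.2, ?_, μ,
    congrArg Subtype.val hf.apply_eq_smul⟩
  have hfr : (f : Vertex h → ℂ) ∈ level h r := f.2.2
  -- Lowering kills `f`: it would land below level 0, or on a level below the endpoint, where `W`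
  -- vanishes.
  rcases hr0 : r with _ | s
  · rw [hr0] at hfr
    exact lowering_mulVec_zero hfr
  · rw [hr0] at hfr
    have hs : s ∉ support N W := Nat.notMem_of_lt_sInf (show s < r by omega)
    rw [hW.mem_support_iff, not_and, not_not] at hs
    exact (Submodule.eq_bot_iff _).1 (hs (by omega)) _
      ⟨hW.lowering_mem f.2.1, lowering_mulVec_mem hfr⟩

/-- An irreducible `T`-module is spanned by a chain of vectors on consecutive levels. -/
theorem IsIrreducibleTModule.exists_chain (hW : IsIrreducibleTModule W) {N : ℕ}
    (hN : Module.finrank F H ≤ N + Module.finrank F h) :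
    ∃ (D : ℕ) (v : ℕ → Vertex h → ℂ), (∀ k, v k ∈ level h (endpoint N W + k)) ∧
      (∀ k, v k ≠ 0 ↔ k ≤ D) ∧ Submodule.span ℂ (Set.range v) = W ∧
      ∀ κ : ℂ, κ ^ 2 = (Nat.card F : ℂ) ^ Module.finrank F H / (Nat.card F : ℂ) ^ D →
        ∀ k, qAdj h *ᵥ v k = v (k + 1) + ladderWeight (Nat.card F : ℂ) κ D k • v (k - 1) := by
  obtain ⟨hT, hbot, hirr⟩ := hW
  obtain ⟨f, hfW, hf0, hfr, hLf, μ, hCf⟩ := hT.exists_bottom_vector hbot hN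
  have hq := card_ne_zero (F := F)
  have hq1 := card_sub_one_ne_zero (F := F)
  have hlow := lowering_raisingChain hfr hLf hCf
  set r := endpoint N W with hr
  set n := Module.finrank F H with hn
  set q : ℂ := (Nat.card F : ℂ) with hqdef
  set ν := q ^ r + (q - 1) * μ with hν
  have hlev := raisingChain_mem_level hfr
  have hex : ∃ k, raisingChain f k = 0 :=
    ⟨N + 1, eq_zero_of_mem_level (by omega) (hlev (N + 1))⟩
  classical
  obtain ⟨D, hD⟩ : ∃ D, Nat.find hex = D + 1 := by
    refine Nat.exists_eq_succ_of_ne_zero fun h0 => hf0 ?_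
    have := Nat.find_spec hex
    rwa [h0] at this
  have hzero : ∀ k, D < k → raisingChain f k = 0 := by
    intro k hk
    induction k, hk using Nat.le_induction with
    | base =>
      have := Nat.find_spec hex
      rwa [hD] at this
    | succ k _ ih => rw [raisingChain_succ, ih, mulVec_zero]
  have hne : ∀ k, raisingChain f k ≠ 0 ↔ k ≤ D := by
    refine fun k => ⟨fun hk => ?_, fun hk => Nat.find_min hex (by omega)⟩
    by_contra hc
    exact hk (hzero k (by omega))
  -- `R ^ (D + 1) f = 0` while `R ^ D f ≠ 0`, so the weight at `D + 1` vanishes. This determines the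
  -- eigenvalue of `C`.
  have hνD : ν = q ^ n / q ^ (r + D) := by
    have h1 := hlow D
    rw [hzero (D + 1) (by omega), mulVec_zero] at h1
    have h2 := (smul_eq_zero.1 h1.symm).resolve_right ((hne D).2 le_rfl)
    have h3 : q ^ (D + 1) - 1 ≠ 0 := sub_ne_zero.2 fun h => by
      have := card_pow_injective (F := F) (show q ^ (D + 1) = q ^ 0 by simpa using h)
      omega
    rw [chainWeight, div_eq_zero_iff, mul_eq_zero] at h2
    have h4 := (h2.resolve_right (pow_ne_zero 2 hq1)).resolve_left h3
    rw [← sub_eq_zero.1 h4]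
    field_simp
    ring
  set U := Submodule.span ℂ (Set.range (raisingChain f)) with hUdef
  have hmemU : ∀ k, raisingChain f k ∈ U := fun k => Submodule.subset_span ⟨k, rfl⟩
  have hpres : ∀ B : Matrix (Vertex h) (Vertex h) ℂ, (∀ k, B *ᵥ raisingChain f k ∈ U) →
      ∀ w ∈ U, B *ᵥ w ∈ U := by
    intro B hB
    have : U ≤ U.comap (toLin' B) := by
      conv_lhs => rw [hUdef]
      rw [Submodule.span_le]
      rintro _ ⟨k, rfl⟩
      exact hB k
    exact this
  have hUT : IsTModule U := by
    refine IsTModule.of_generators (hpres _ fun k => ?_) (hpres _ fun k => ?_) (hpres _ fun k => ?_)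
    · rw [← raisingChain_succ]
      exact hmemU _
    · rcases k with _ | k
      · exact (show lowering h *ᵥ raisingChain f 0 = 0 from hLf) ▸ zero_mem U
      · rw [hlow]
        exact U.smul_mem _ (hmemU k)
    · rw [dualAdj_mulVec (hlev k)]
      exact U.smul_mem _ (hmemU k)
  have hUW : U ≤ W := by
    rw [hUdef, Submodule.span_le]
    rintro _ ⟨k, rfl⟩
    induction k with
    | zero => exact hfW
    | succ k ih => rw [raisingChain_succ]; exact hT.raising_mem ih
  have hU : U = W := (hirr U hUT hUW).resolve_left fun h0 =>
    hf0 ((Submodule.eq_bot_iff U).1 h0 f (hmemU 0))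
  refine ⟨D, raisingChain f, hlev, hne, hU, fun κ hκ k => ?_⟩
  rw [qAdj_mulVec (hlev k), ← raisingChain_succ]
  congr 1
  rcases k with _ | k
  · rw [show raisingChain f 0 = f from rfl, hLf, ladderWeight]
    simp
  · rw [hlow, smul_smul, Nat.add_sub_cancel]
    congr 1
    rw [ladderWeight, hκ, chainWeight, hνD, ← hqdef]
    field_simp
    ring

end Irreducible

end AttenuatedSpace

/-! ### Real exponents, the support of a module and the main theorem. -/

namespace AttenuatedSpace

open Matrix Module

section RealPowers

variable {q : ℕ}

lemma theta_add_eq (hq : 0 < q) {N M d : ℕ} {t : ℝ} (ht : t = ((N : ℝ) - d) / 2) (i : ℕ) :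
    (theta q N M (t + i) : ℂ) =
      ladderEigenvalue (q : ℂ) (((q : ℝ) ^ ((M : ℝ) / 2 + t) : ℝ) : ℂ) d i := by
  have hq' : (0 : ℝ) < q := by exact_mod_cast hq
  have h1 : (N : ℝ) - (t + i) = t + d - i := by rw [ht]; ring
  rw [theta, ladderEigenvalue, h1, Real.rpow_sub hq', Real.rpow_add hq', Real.rpow_add hq',
    Real.rpow_add hq', Real.rpow_natCast, Real.rpow_natCast]
  push_cast
  ring

lemma eigenvalue_eq (hq : 0 < q) {M d : ℕ} {t : ℝ} (i : ℕ) :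
    ((((q : ℝ) ^ ((d : ℝ) - i) - (q : ℝ) ^ (i : ℝ)) / ((q : ℝ) - 1) *
      (q : ℝ) ^ ((M : ℝ) / 2 + t) : ℝ) : ℂ) =
      ladderEigenvalue (q : ℂ) (((q : ℝ) ^ ((M : ℝ) / 2 + t) : ℝ) : ℂ) d i := by
  have hq' : (0 : ℝ) < q := by exact_mod_cast hq
  rw [ladderEigenvalue, Real.rpow_sub hq', Real.rpow_natCast, Real.rpow_natCast]
  push_cast
  ring

/-- This is where `t = (N - d) / 2` comes from: `κ = q ^ (M / 2 + t)` must satisfy `κ ^ 2 = q ^ (N +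
M - d)`. -/
lemma rpow_half_sq (hq : 0 < q) {N M d : ℕ} {t : ℝ} (ht : t = ((N : ℝ) - d) / 2) :
    (((q : ℝ) ^ ((M : ℝ) / 2 + t) : ℝ) : ℂ) ^ 2 = (q : ℂ) ^ (N + M) / (q : ℂ) ^ d := by
  have hq' : (0 : ℝ) < q := by exact_mod_cast hq
  have h1 : ((M : ℝ) / 2 + t) * (2 : ℕ) = ((N + M : ℕ) : ℝ) - (d : ℝ) := by
    rw [ht]; push_cast; ring
  rw [← Complex.ofReal_pow, ← Real.rpow_mul_natCast hq'.le, h1, Real.rpow_sub hq',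
    Real.rpow_natCast, Real.rpow_natCast]
  push_cast
  rfl

end RealPowers

variable {F H : Type*} [Field F] [AddCommGroup H] [Module F H] {h : Submodule F H}
  [FiniteDimensional F H] [Finite F] {W : Submodule ℂ (Vertex h → ℂ)}

lemma support_eq_Icc (hW : IsTModule W) {N r D : ℕ}
    (hN : Module.finrank F H ≤ N + Module.finrank F h) {v : ℕ → Vertex h → ℂ}
    (hv : ∀ k, v k ∈ level h (r + k)) (hne : ∀ k, v k ≠ 0 ↔ k ≤ D)
    (hspan : Submodule.span ℂ (Set.range v) = W) : support N W = Set.Icc r (r + D) := by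
  ext i
  rw [hW.mem_support_iff, Set.mem_Icc]
  constructor
  · rintro ⟨-, hi⟩
    by_contra hc
    refine hi ((Submodule.eq_bot_iff _).2 fun w hw => ?_)
    have h1 : W ≤ LinearMap.ker (toLin' (dualIdem h i)) := by
      rw [← hspan, Submodule.span_le]
      rintro _ ⟨k, rfl⟩
      change dualIdem h i *ᵥ v k = 0
      rw [dualIdem_mulVec i (hv k)]
      split_ifs with hik
      · by_contra h0
        have := (hne k).1 h0
        omega
      · rfl
    have h2 : dualIdem h i *ᵥ w = 0 := h1 hw.1
    rwa [dualIdem_mulVec i hw.2, if_pos rfl] at h2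
  · rintro ⟨h1, h2⟩
    obtain ⟨k, rfl⟩ := Nat.exists_eq_add_of_le h1
    have hk : v k ≠ 0 := (hne k).2 (by omega)
    constructor
    · by_contra hc
      exact hk (eq_zero_of_mem_level (by omega) (hv k))
    · rw [Submodule.ne_bot_iff]
      exact ⟨v k, ⟨hspan ▸ Submodule.subset_span ⟨k, rfl⟩, hv k⟩, hk⟩

/-- The nonzero vectors of a chain on consecutive levels form a basis of their span. -/
lemma exists_chain_basis {r D : ℕ} {v : ℕ → W}
    (hv : ∀ k, (v k : Vertex h → ℂ) ∈ level h (r + k)) (hne : ∀ k, v k ≠ 0 ↔ k ≤ D)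
    (hspan : Submodule.span ℂ (Set.range v) = ⊤) :
    ∃ b : Basis (Fin (D + 1)) ℂ W, ∀ i : Fin (D + 1), b i = v i := by
  have hli : LinearIndependent ℂ fun i : Fin (D + 1) => v i := by
    refine LinearIndependent.of_comp W.subtype ?_
    refine End.eigenvectors_linearIndependent' (toLin' (dualAdj h))
      -- Chain vectors are independent as eigenvectors of `A*` for distinct eigenvalues.
      (fun i : Fin (D + 1) => ((Nat.card F : ℂ) ^ (r + i))⁻¹) ?_ _ fun i => ⟨?_, ?_⟩
    · intro i j hij
      have h1 : r + (i : ℕ) = r + j := card_pow_injective (inv_injective hij)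
      exact Fin.ext (by omega)
    · exact End.mem_eigenspace_iff.2 (dualAdj_mulVec (hv i))
    · exact fun h0 => (hne i).2 (by omega) (Subtype.ext h0)
  have hsp : ⊤ ≤ Submodule.span ℂ (Set.range fun i : Fin (D + 1) => v i) := by
    rw [← hspan, Submodule.span_le]
    rintro _ ⟨k, rfl⟩
    by_cases hk : k ≤ D
    · exact Submodule.subset_span ⟨⟨k, by omega⟩, rfl⟩
    · have h0 : v k = 0 := by
        by_contra hc
        exact hk ((hne k).1 hc)
      exact h0 ▸ zero_mem _
  exact ⟨Basis.mk hli hsp, fun i => by simp⟩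

end AttenuatedSpace
end

open AttenuatedSpace Matrix in
theorem mainTheorem9 {F H : Type*} [Field F] [Finite F] [AddCommGroup H] [Module F H]
    [FiniteDimensional F H] (q N M : ℕ) (hN : 0 < N) (hM : 0 < M) (hq : Nat.card F = q)
    (hH : Module.finrank F H = N + M) (h : Submodule F H) (hh : Module.finrank F h = M)
    (W : Submodule ℂ (Vertex h → ℂ)) (hW : IsIrreducibleTModule W)
    (r d : ℕ) (hr : endpoint N W = r) (hd : diameter N W = d)
    (t : ℝ) (ht : t = ((N : ℝ) - d) / 2) :
    ∃ Φ : LeonardSystem ℂ W d,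
      -- `Φ` consists of the restrictions to `W` of `A`, `E_{t+i}`, `A*`, `E*_{r+i}`
      (∀ w : W, (Φ.A w : Vertex h → ℂ) = qAdj h *ᵥ (w : Vertex h → ℂ)) ∧
      (∀ (i : Fin (d + 1)) (w : W),
        (Φ.E i w : Vertex h → ℂ) = idem h N M (t + (i : ℕ)) *ᵥ (w : Vertex h → ℂ)) ∧
      (∀ w : W, (Φ.As w : Vertex h → ℂ) = dualAdj h *ᵥ (w : Vertex h → ℂ)) ∧
      (∀ (i : Fin (d + 1)) (w : W),
        (Φ.Es i w : Vertex h → ℂ) = dualIdem h (r + i) *ᵥ (w : Vertex h → ℂ)) ∧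
      IsLeonardPair Φ.A Φ.As ∧
      Φ.IsBipartite ∧
      IsEigenvalueSequence Φ.A Φ.E (fun i =>
        ((((q : ℝ) ^ ((d : ℝ) - (i : ℕ)) - (q : ℝ) ^ ((i : ℕ) : ℝ)) / ((q : ℝ) - 1) *
          (q : ℝ) ^ ((M : ℝ) / 2 + t) : ℝ) : ℂ)) ∧
      IsEigenvalueSequence Φ.As Φ.Es (fun i => (q : ℂ) ^ (-(r : ℤ) - (i : ℕ))) ∧
      Φ.IsDualQKrawtchouk (q : ℂ)
        (((q : ℝ) ^ ((d : ℝ) + t + (M : ℝ) / 2) / ((q : ℝ) - 1) : ℝ) : ℂ)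
        ((q : ℂ) ^ (-(r : ℤ)))
        (-(q : ℂ) ^ (-(d : ℤ) - 1))
        ((((q : ℝ) ^ (d : ℝ) - 1) / ((q : ℝ) - 1) * (q : ℝ) ^ ((M : ℝ) / 2 + t) : ℝ) : ℂ)
        ((q : ℂ) ^ (-(r : ℤ))) := by
  have hdim : Module.finrank F H ≤ N + Module.finrank F h := by omega
  have hT := hW.1
  obtain ⟨D, v, hlev, hne, hspan, hqAdj⟩ := hW.exists_chain hdim
  rw [hr] at hlev
  have hsupp := support_eq_Icc hT hdim hlev hne hspan
  obtain rfl : D = d := by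
    rw [← hd, diameter, hsupp, Set.ncard_eq_toFinset_card', Set.toFinset_Icc, Nat.card_Icc]
    omega
  subst hq
  have hpos : 0 < Nat.card F := Nat.card_pos
  have hq0 := card_ne_zero (F := F)
  set κ : ℂ := (((Nat.card F : ℝ) ^ ((M : ℝ) / 2 + t) : ℝ) : ℂ) with hκ
  have hκ2 := rpow_half_sq hpos (M := M) ht
  have hκ0 : κ ≠ 0 := fun h0 => by
    rw [← hκ, h0, zero_pow two_ne_zero] at hκ2
    exact div_ne_zero (pow_ne_zero _ hq0) (pow_ne_zero _ hq0) hκ2.symm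
  have hA := hqAdj κ (by rw [hH]; exact hκ2)
  have hvW : ∀ k, v k ∈ W := fun k => hspan ▸ Submodule.subset_span ⟨k, rfl⟩
  have hAW : ∀ w ∈ W, toLin' (qAdj h) w ∈ W := by
    have : W ≤ W.comap (toLin' (qAdj h)) := by
      conv_lhs => rw [← hspan]
      rw [Submodule.span_le]
      rintro _ ⟨k, rfl⟩
      change qAdj h *ᵥ v k ∈ W
      rw [hA]
      exact add_mem (hvW _) (W.smul_mem _ (hvW _))
    exact this
  have hAsW : ∀ w ∈ W, toLin' (dualAdj h) w ∈ W := fun w hw => hT.dualAdj_mem hw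
  set u : ℕ → W := fun k => ⟨v k, hvW k⟩ with hu
  have hune : ∀ k, u k ≠ 0 ↔ k ≤ D := fun k => by
    rw [← hne k, hu, Ne, ← Submodule.coe_eq_zero]
  have huspan : Submodule.span ℂ (Set.range u) = ⊤ := by
    apply Submodule.map_injective_of_injective W.subtype_injective
    rw [Submodule.map_span, ← Set.range_comp, Submodule.map_subtype_top]
    exact hspan
  obtain ⟨b, hb⟩ := exists_chain_basis hlev hune huspan
  have hL : IsLadder (Nat.card F : ℂ) κ ((Nat.card F : ℂ) ^ (-(r : ℤ))) D
      ((toLin' (qAdj h)).restrict hAW) ((toLin' (dualAdj h)).restrict hAsW) u := by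
    refine ⟨fun k => Subtype.ext (hA k), fun k => Subtype.ext ?_, fun k hk => ?_⟩
    · refine (dualAdj_mulVec (hlev k)).trans ?_
      rw [_root_.zpow_neg, zpow_natCast, pow_add, mul_inv, ← div_eq_mul_inv]
      rfl
    · by_contra hc
      exact absurd ((hune k).1 hc) (by omega)
  obtain ⟨Φ, hΦA, hΦAs, hmf, hLP, hbip, hE, hEs, hK⟩ := hL.exists_leonardSystem b hb hq0
    card_pow_injective hκ0 (zpow_ne_zero _ hq0)
  have hAsb : ∀ i : Fin (D + 1), (toLin' (dualAdj h)).restrict hAsW (b i) =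
      ((Nat.card F : ℂ) ^ (-(r : ℤ)) / (Nat.card F : ℂ) ^ (i : ℕ)) • b i := fun i => by
    rw [hb, hL.dual_apply]
  refine ⟨Φ, fun w => by rw [hΦA]; rfl, fun i w => ?_, fun w => by rw [hΦAs]; rfl, fun i w => ?_,
    by rw [hΦA, hΦAs]; exact hLP, hbip, ?_, ?_, ?_⟩
  · rw [hE.2.2 i, idem, ← toLin'_apply, toLin'_toMatrix', theta_add_eq hpos ht]
    exact primitiveIdempotent_restrict iSup_eigenspace_qAdj (fun _ => rfl) hmf.1 _ w
  · rw [hEs.2.2 i]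
    -- Both sides are compared on the chain basis, which has one vector on each level `r + k`.
    have : W.subtype ∘ₗ primitiveIdempotent ((toLin' (dualAdj h)).restrict hAsW)
        ((Nat.card F : ℂ) ^ (-(r : ℤ)) / (Nat.card F : ℂ) ^ (i : ℕ)) =
        toLin' (dualIdem h (r + i)) ∘ₗ W.subtype := by
      refine b.ext fun k => ?_
      have h1 := primitiveIdempotent_apply_of_eigenbasis b hAsb hEs.1 i (b k)
      have h2 : dualIdem h (r + i) *ᵥ (b k : Vertex h → ℂ) =
          if r + (i : ℕ) = r + k then (b k : Vertex h → ℂ) else 0 := by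
        rw [hb]
        exact dualIdem_mulVec _ (hlev k)
      rw [LinearMap.comp_apply, h1, LinearMap.comp_apply, toLin'_apply, Submodule.subtype_apply,
        Submodule.subtype_apply, h2, Module.Basis.repr_self, Finsupp.single_apply]
      by_cases hik : k = i
      · subst hik
        simp
      · have : r + (i : ℕ) ≠ r + k := fun h => hik (Fin.ext (by omega))
        rw [if_neg hik, if_neg this, zero_smul, Submodule.coe_zero]
    exact LinearMap.congr_fun this w
  · rw [hΦA]
    convert hE using 2 with i
    exact eigenvalue_eq hpos i
  · rw [hΦAs]
    convert hEs using 2 with i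
    rw [zpow_sub₀ hq0, zpow_natCast]
  · have hpos' : (0 : ℝ) < Nat.card F := by exact_mod_cast hpos
    convert hK using 1
    · rw [hκ, add_assoc, add_comm t, Real.rpow_add hpos', Real.rpow_natCast]
      push_cast
      ring
    · rw [hκ, Real.rpow_natCast]
      push_cast
      ring
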